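/- **Theorem (Gravitational objective outcome paradox).** *Setting.* All systems are finite-dimensional. Alice falls into a black hole $B$ carrying a qubit $Q$; she and her equipment $L$ are initially in a pure state $|\varphi\rangle_L$. The black hole is older than the Page time: $B$ is maximally entangled with the early Hawking radiation $R$, which is held by Bob; that is, $BR$ is in a state $|B|^{-1/2}\sum_b|b\rangle_B|w_b\rangle_R$ with $(w_b)_b$ orthonormal. From the outside perspective, Alice's measurement of $Q$ in the computational basis is a unitary $V$ on $QL$ with $V|a\rangle|\varphi\rangle=|a\rangle|r_a\rangle$ for $a\in\{0,1\}$, where $r_0\perp r_1$ are unit vectors (her records). It is followed by a scrambling unitary $U$ on $QLB\cong B'R'$, distributed according to the Haar probability measure (Hayden–Preskill model); $R'$ is radiated to Bob and $B'$ is the remaining black hole. For an initial state $\rho_{QS}$, with $S$ any reference system outside the black hole, and a channel (completely positive trace-preserving map) $D$ from $R'R$ to a qubit $Q_R$, let $\tilde\rho_{Q_RS}$ be the state that results from this evolution, tracing out $B'$, and applying $D$. Bob measures $Q_R$ in the diagonal basis $|\bar b\rangle=(|0\rangle+(-1)^b|1\rangle)/\sqrt2$, $b\in\{0,1\}$. *Assumptions.*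 For given $U$, $D$, $S$ and $\varepsilon>0$, and for updated descriptions $\alpha_a(\rho_{QS})$ (Alice's) and $\beta_b(\rho_{QS})$ (Bob's), which are operators on $S$, consider: 1. *Executability:* $D$ reconstructs $Q$ up to error $\varepsilon$: for every finite-dimensional reference system and every state $\rho$ of $Q$ and that system, the trace distance between $\tilde\rho$ and $\rho$ is at most $\varepsilon$. 2. *Universality of quantum theory:* for all states $\rho_{QS}$ and all $a,b$, $\alpha_a(\rho_{QS})=\operatorname{tr}_Q(|a\rangle\langle a|_Q\,\rho_{QS})$ and $\beta_b(\rho_{QS})=\operatorname{tr}_{Q_R}(|\bar b\rangle\langle\bar b|_{Q_R}\,\tilde\rho_{Q_RS})$. 3. *Objective measurement outcomes:* there is a rule that assigns to every state $\rho_{QS}$ a probability distribution $P(a,b)$ on pairs of outcomes and density operators $\sigma_{a,b}$ on $S$ such that $\sum_bP(a,b)\,\sigma_{a,b}=\alpha_a(\rho_{QS})$ for all $a$ and $\sum_aP(a,b)\,\sigma_{a,b}=\beta_b(\rho_{QS})$ for all $b$. *Claim.* For all $0<\varepsilon<\tfrac12$ and $\delta>0$ there is a constant $K>0$, depending only on $\varepsilon$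 and $\delta$, such that whenever $|R'|^2\ge K\,|L|$ (where $|\cdot|$ denotes the dimension), the following hold: - with Haar probability at least $1-\delta$, the unitary $U$ is such that there is a channel $D$ for which assumption 1 holds; - for every unitary $U$, every channel $D$, every reference system $S$ of dimension at least two and all descriptions $\alpha,\beta$, assumptions 1, 2 and 3 cannot all hold. -/

import Mathlib

open scoped Matrix Kronecker ComplexOrder

noncomputable section

namespace HaydenPreskill

/-! ### Finite-dimensional quantum theory

A finite-dimensional system with an orthonormal basis labelled by the finite type `I` has Hilbert
space `I → ℂ`; its operators are `Matrix I I ℂ`; `I × J` labels the product basis of the composite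
of `I` and `J`.  A qubit is labelled by `Fin 2`. -/

/-- Density operators: positive semidefinite with unit trace. -/
def IsDensity {I : Type} [Fintype I] (ρ : Matrix I I ℂ) : Prop :=
  ρ.PosSemidef ∧ ρ.trace = 1

/-- A finite family of vectors is orthonormal for the standard inner product. -/
def IsOrthonormal {J I : Type} [DecidableEq J] [Fintype I] (v : J → I → ℂ) : Prop :=
  ∀ i j, star (v i) ⬝ᵥ v j = if i = j then 1 else 0

/-- The computational basis `|0⟩, |1⟩` of a qubit. -/
def compKet (a : Fin 2) : Fin 2 → ℂ := Pi.single a 1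

/-- The diagonal basis `(|0⟩ + |1⟩)/√2, (|0⟩ - |1⟩)/√2` of a qubit. -/
def diagKet (b : Fin 2) : Fin 2 → ℂ :=
  fun q => ((Real.sqrt 2 : ℝ) : ℂ)⁻¹ * (-1) ^ ((b : ℕ) * (q : ℕ))

/-- Partial trace over the first factor. -/
def partialTraceFst {I S : Type} [Fintype I] (X : Matrix (I × S) (I × S) ℂ) : Matrix S S ℂ :=
  Matrix.of fun s s' => ∑ i, X (i, s) (i, s')

/-- The unnormalised state `tr_Q (|v⟩⟨v|_Q ρ_{QS})` of `S` conditioned on the outcome `|v⟩` of a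
projective measurement of the qubit `Q`; its trace is the Born probability of that outcome. -/
def measuredState {S : Type} [Fintype S] [DecidableEq S] (v : Fin 2 → ℂ)
    (ρ : Matrix (Fin 2 × S) (Fin 2 × S) ℂ) : Matrix S S ℂ :=
  partialTraceFst ((Matrix.vecMulVec v (star v) ⊗ₖ (1 : Matrix S S ℂ)) * ρ)

/-- Quantum channels (completely positive trace-preserving maps), by a Kraus decomposition. -/
def IsChannel {I O : Type} [Fintype I] [DecidableEq I] [Fintype O]
    (Φ : Matrix I I ℂ →ₗ[ℂ] Matrix O O ℂ) : Prop :=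
  ∃ (k : ℕ) (K : Fin k → Matrix O I ℂ),
    ∑ j, (K j)ᴴ * K j = 1 ∧ ∀ X, Φ X = ∑ j, K j * X * (K j)ᴴ

/-- `Φ ⊗ id_S`: a linear map on the operators of `I`, extended to act trivially on `S`. -/
def extend {I O : Type} (Φ : Matrix I I ℂ →ₗ[ℂ] Matrix O O ℂ) (S : Type)
    (ρ : Matrix (I × S) (I × S) ℂ) : Matrix (O × S) (O × S) ℂ :=
  Matrix.of fun x y => Φ (Matrix.of fun i j => ρ (i, x.2) (j, y.2)) x.1 y.1

/-- Two states have trace distance at most `ε`: no measurement effect `0 ≤ E ≤ 1` has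
probabilities in the two states that differ by more than `ε`. -/
def TraceDistLE {I : Type} [Fintype I] [DecidableEq I] (ρ σ : Matrix I I ℂ) (ε : ℝ) : Prop :=
  ∀ E : Matrix I I ℂ, E.PosSemidef → (1 - E).PosSemidef →
    |(E * ρ).trace.re - (E * σ).trace.re| ≤ ε

/-! ### The Haar probability measure on the unitary group -/

instance unitaryMeasurableSpace (n : Type) [Fintype n] [DecidableEq n] :
    MeasurableSpace (Matrix.unitaryGroup n ℂ) := borel _

instance unitaryBorelSpace (n : Type) [Fintype n] [DecidableEq n] :
    BorelSpace (Matrix.unitaryGroup n ℂ) := ⟨rfl⟩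

instance unitaryCompactSpace (n : Type) [Fintype n] [DecidableEq n] :
    CompactSpace (Matrix.unitaryGroup n ℂ) := by
  suffices h : IsCompact (Matrix.unitaryGroup n ℂ : Set (Matrix n n ℂ)) from
    isCompact_iff_compactSpace.mp h
  have hc : IsCompact (Set.pi Set.univ fun _ : n => Set.pi Set.univ fun _ : n =>
      Metric.closedBall (0 : ℂ) 1) :=
    isCompact_univ_pi fun _ => isCompact_univ_pi fun _ => isCompact_closedBall _ _
  refine IsCompact.of_isClosed_subset (hc : IsCompact (X := Matrix n n ℂ) _) ?_ ?_
  · have h : (Matrix.unitaryGroup n ℂ : Set (Matrix n n ℂ)) =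
        (fun A : Matrix n n ℂ => star A * A) ⁻¹' {1} := by
      ext A
      exact Matrix.mem_unitaryGroup_iff'
    rw [h]
    exact isClosed_singleton.preimage (by fun_prop)
  · intro A hA i _ j _
    simpa using entry_norm_bound_of_unitary hA i j

/-- The Haar measure on the unitary group, normalised to total mass one. -/
def haarUnitary (n : Type) [Fintype n] [DecidableEq n] :
    MeasureTheory.Measure (Matrix.unitaryGroup n ℂ) :=
  MeasureTheory.Measure.haarMeasure ⊤

/-! ### The Hayden–Preskill model of an old black hole with Alice falling in -/

/-- The data of the experiment, as described from the outside.  `L` is Alice together with her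
equipment, `B` the black hole before Alice falls in, `R` the early Hawking radiation held by Bob,
`R'` the radiation collected afterwards, `B'` the remaining black hole. -/
structure Experiment (L B R B' R' : Type) [Fintype L] [DecidableEq L] [DecidableEq B]
    [Fintype R] where
  /-- Alice is initially in a pure state. -/
  lab : L → ℂ
  lab_unit : star lab ⬝ᵥ lab = 1
  /-- The state of Alice after having recorded the outcome `a`; different records are perfectly
  distinguishable. -/
  record : Fin 2 → L → ℂ
  record_orthonormal : IsOrthonormal record
  /-- Alice's measurement, which for an outside physicist is a unitary on `Q` and `L`. -/
  meas : Matrix.unitaryGroup (Fin 2 × L) ℂ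
  /-- It is a projective measurement in the computational basis followed by a record. -/
  meas_spec : ∀ a : Fin 2, (meas : Matrix (Fin 2 × L) (Fin 2 × L) ℂ) *ᵥ
      (fun x => compKet a x.1 * lab x.2) = fun x => compKet a x.1 * record a x.2
  /-- The black hole is older than the Page time: `B` is maximally entangled with the early
  radiation, in the state `|B|^(-1/2) ∑ b, |b⟩ ⊗ |partner b⟩`. -/
  partner : B → R → ℂ
  partner_orthonormal : IsOrthonormal partner
  /-- After scrambling, the black hole that has absorbed `Q` and Alice consists of the newly
  radiated system `R'` and the rest `B'`. -/
  split : (Fin 2 × L) × B ≃ B' × R'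

namespace Experiment

variable {L B R B' R' : Type} [Fintype L] [DecidableEq L] [Fintype B] [DecidableEq B]
  [Fintype R] [DecidableEq R] [Fintype B'] [Fintype R']

/-- The isometry `|q⟩ ↦ |q⟩_Q |lab⟩_L |Φ⟩_{BR}` that adds Alice, the black hole and the early
radiation to `Q`. -/
def prepare (X : Experiment L B R B' R') : Matrix (((Fin 2 × L) × B) × R) (Fin 2) ℂ :=
  Matrix.of fun x q => compKet q x.1.1.1 * X.lab x.1.1.2 *
    (((Real.sqrt (Fintype.card B) : ℝ) : ℂ)⁻¹ * X.partner x.1.2 x.2)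

/-- Evolution from the outside perspective: Alice measures inside the black hole, and `Q`, Alice
and the black hole are scrambled by `U`; nothing happens to the early radiation. -/
def evolve (X : Experiment L B R B' R') (U : Matrix.unitaryGroup ((Fin 2 × L) × B) ℂ) :
    Matrix (((Fin 2 × L) × B) × R) (Fin 2) ℂ :=
  (((U : Matrix ((Fin 2 × L) × B) ((Fin 2 × L) × B) ℂ) *
      ((X.meas : Matrix (Fin 2 × L) (Fin 2 × L) ℂ) ⊗ₖ (1 : Matrix B B ℂ))) ⊗ₖ
    (1 : Matrix R R ℂ)) * X.prepare

/-- The map from the operators of `Q` to those of the radiation `R' R` available to Bob: evolve,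
then trace out the remaining black hole `B'`. -/
def toRadiation (X : Experiment L B R B' R') (U : Matrix.unitaryGroup ((Fin 2 × L) × B) ℂ) :
    Matrix (Fin 2) (Fin 2) ℂ →ₗ[ℂ] Matrix (R' × R) (R' × R) ℂ where
  toFun ρ := Matrix.of fun x y => ∑ b' : B',
    (X.evolve U * ρ * (X.evolve U)ᴴ) (X.split.symm (b', x.1), x.2) (X.split.symm (b', y.1), y.2)
  map_add' ρ σ := by
    ext x y
    simp [Matrix.mul_add, Matrix.add_mul, Finset.sum_add_distrib]
  map_smul' c ρ := by
    ext x y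
    simp [Finset.mul_sum]

/-- Bob's description of `Q_R S` after having applied the decoder `D` to the radiation, if `Q` and
a reference system `S` outside the black hole were initially in the state `ρ`. -/
def bobState (X : Experiment L B R B' R') (U : Matrix.unitaryGroup ((Fin 2 × L) × B) ℂ)
    (D : Matrix (R' × R) (R' × R) ℂ →ₗ[ℂ] Matrix (Fin 2) (Fin 2) ℂ) (S : Type)
    (ρ : Matrix (Fin 2 × S) (Fin 2 × S) ℂ) : Matrix (Fin 2 × S) (Fin 2 × S) ℂ :=
  extend (D ∘ₗ X.toRadiation U) S ρ

/-- Executability: `D` is a physical operation by which Bob reconstructs the qubit `Q` from the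
radiation, up to an error `ε` and preserving correlations of `Q` with any reference system. -/
def Executable (X : Experiment L B R B' R') [DecidableEq R']
    (U : Matrix.unitaryGroup ((Fin 2 × L) × B) ℂ)
    (D : Matrix (R' × R) (R' × R) ℂ →ₗ[ℂ] Matrix (Fin 2) (Fin 2) ℂ) (ε : ℝ) : Prop :=
  IsChannel D ∧ ∀ (S : Type) [Fintype S] [DecidableEq S]
    (ρ : Matrix (Fin 2 × S) (Fin 2 × S) ℂ), IsDensity ρ →
      TraceDistLE (X.bobState U D S ρ) ρ ε

end Experiment

/-- What Alice and Bob say about a reference system `S`: to the initial state of `Q S` and to the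
outcome obtained, each of them assigns an (unnormalised) updated state of `S`, whose trace is the
probability of the outcome. -/
structure Descriptions (S : Type) where
  alice : Matrix (Fin 2 × S) (Fin 2 × S) ℂ → Fin 2 → Matrix S S ℂ
  bob : Matrix (Fin 2 × S) (Fin 2 × S) ℂ → Fin 2 → Matrix S S ℂ

/-- Universality of quantum theory: Alice updates by her measurement of `Q` in the computational
basis; Bob, who describes Alice and the black hole as a quantum system, updates by his measurement
of the reconstructed qubit `Q_R` in the diagonal basis. -/
def UniversalQuantumTheory {L B R B' R' : Type} [Fintype L] [DecidableEq L] [Fintype B]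
    [DecidableEq B] [Fintype R] [DecidableEq R] [Fintype B'] [Fintype R']
    (X : Experiment L B R B' R') (U : Matrix.unitaryGroup ((Fin 2 × L) × B) ℂ)
    (D : Matrix (R' × R) (R' × R) ℂ →ₗ[ℂ] Matrix (Fin 2) (Fin 2) ℂ)
    {S : Type} [Fintype S] [DecidableEq S] (d : Descriptions S) : Prop :=
  ∀ ρ, IsDensity ρ →
    (∀ a, d.alice ρ a = measuredState (compKet a) ρ) ∧
    (∀ b, d.bob ρ b = measuredState (diagKet b) (X.bobState U D S ρ))

/-- A rule that assigns to an initial state of `Q S` and to a pair of outcomes `a` (Alice's) and `b`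
(Bob's) the probability of the pair and the state of `S` updated with both. -/
structure UpdateRule (S : Type) [Fintype S] where
  prob : Matrix (Fin 2 × S) (Fin 2 × S) ℂ → Fin 2 → Fin 2 → ℝ
  post : Matrix (Fin 2 × S) (Fin 2 × S) ℂ → Fin 2 → Fin 2 → Matrix S S ℂ
  prob_nonneg : ∀ ρ, IsDensity ρ → ∀ a b, 0 ≤ prob ρ a b
  prob_sum : ∀ ρ, IsDensity ρ → ∑ a, ∑ b, prob ρ a b = 1
  post_density : ∀ ρ, IsDensity ρ → ∀ a b, IsDensity (post ρ a b)

/-- Objective measurement outcomes: some rule updates with both outcomes, compatibly with the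
description of each physicist who knows only one of them. -/
def ObjectiveOutcomes {S : Type} [Fintype S] (d : Descriptions S) : Prop :=
  ∃ F : UpdateRule S, ∀ ρ, IsDensity ρ →
    (∀ a, ∑ b, (F.prob ρ a b : ℂ) • F.post ρ a b = d.alice ρ a) ∧
    (∀ b, ∑ a, (F.prob ρ a b : ℂ) • F.post ρ a b = d.bob ρ b)

end HaydenPreskill

end

open HaydenPreskill

/-!
The claim has two independent parts.

**Decoding.** Alice's measurement and the absorption of `Q` and `L` by the black hole are described
by an isometry `J` from `Q B` to `Q L B` (`Experiment.recordIsometry`). Put `Z = U J`. Since the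
early radiation purifies `B`, the Kraus operators `M k` of the channel from `Q` to the radiation
`R' R`, labelled by the basis states `k` of `B'`, have products `(M k)ᴴ (M l)` that are the blocks
of the matrix `gram` of `Z` (`Experiment.blockRow_gram`). Decoding is exactly possible if this
matrix is `|B'|⁻¹ 1`, the Knill–Laflamme condition. Two facts make this robust.

* *Decoupling* (`integral_frobSq_gram_le`). The squared Hilbert–Schmidt norm of `gram` is linear in
  `(U ⊗ U)ᴴ F (U ⊗ U)`, where `F` swaps two copies of `B'`. By invariance of the Haar measure the
  average of this operator commutes with all `V ⊗ V`, so it is a combination of the identity and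
  the swap (`exists_eq_smul_one_add_smul_swap`), and two traces determine the coefficients
  (`exists_twirlMean_eq`). Hence the average of `‖gram - |B'|⁻¹ 1‖²` is at most `4 / (|B| |R'|)`.
* *Recovery* (`exists_recovery`). If `G = Mᴴ M` is close to `c² 1`, then
  `P = 2 c (M Mᴴ + c²)⁻¹ M` is a contraction with `Pᴴ M` close to `c`
  (`exists_approximate_inverse`). This rational function of `M` replaces the polar decomposition:
  it needs no spectral calculus, and both its error and its defect are controlled by
  `‖G - c²‖² / c²`. So `P` yields a decoder whose composition with the channel has Kraus operators
  close to scalars, and `abs_trace_sub_le` turns this into a bound on the trace distance, uniformly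
  in the reference system.

With `|B'| |R'| = 2 |L| |B|`, Markov's inequality bounds the probability of failure by
`32 |L| / (ε² |R'|²)`, whence the constant `K = 32 / (ε² δ)`.

**Paradox.** Let `Q` be maximally entangled with two basis vectors of `S`. Alice's updated states
are then multiples of basis projections, so each state conditioned on both outcomes is one too, and
Bob's updated states, being sums of those, have no coherence. Measuring `S` in the diagonal basis
therefore agrees with Bob's outcome with probability `1 / 2`
(`trace_corrMatrix_mul_of_objective`), while a decoder with error `ε` guarantees `1 - ε`.
-/

namespace HaydenPreskill

open MeasureTheory

/-! ### The commutant of `V ⊗ V` -/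

/-- The operator exchanging the two factors of `n × n`. -/
def swapMatrix (n : Type) [DecidableEq n] : Matrix (n × n) (n × n) ℂ :=
  Equiv.Perm.permMatrix ℂ (Equiv.prodComm n n)

section Commutant

variable {n : Type} [DecidableEq n]

lemma swapMatrix_apply (x y : n × n) :
    swapMatrix n x y = if x.1 = y.2 ∧ x.2 = y.1 then 1 else 0 := by
  obtain ⟨a, b⟩ := x
  obtain ⟨c, d⟩ := y
  simp only [swapMatrix, Equiv.Perm.permMatrix, PEquiv.toMatrix_apply, Equiv.toPEquiv_apply,
    Equiv.prodComm_apply, Prod.swap_prod_mk, Option.mem_def, Option.some.injEq, Prod.mk.injEq]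
  exact if_congr and_comm rfl rfl

lemma permMatrix_kronecker_permMatrix (σ : Equiv.Perm n) :
    σ.permMatrix ℂ ⊗ₖ σ.permMatrix ℂ = Equiv.Perm.permMatrix ℂ (σ.prodCongr σ) := by
  ext ⟨a, b⟩ ⟨c, d⟩
  simp only [Equiv.Perm.permMatrix, Matrix.kroneckerMap_apply, PEquiv.toMatrix_apply,
    Equiv.toPEquiv_apply, Option.mem_def, Option.some.injEq, Equiv.prodCongr_apply, Prod.map_apply,
    Prod.mk.injEq]
  split_ifs <;> simp_all

variable [Fintype n]

lemma permMatrix_mul_apply {m k : Type} [Fintype m] [DecidableEq m] (σ : Equiv.Perm m)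
    (Y : Matrix m k ℂ) (x : m) (y : k) : (σ.permMatrix ℂ * Y) x y = Y (σ x) y := by
  simp [Matrix.mul_apply, Equiv.Perm.permMatrix, PEquiv.toMatrix_apply]

lemma mul_permMatrix_apply {m : Type} [Fintype m] [DecidableEq m] (σ : Equiv.Perm m)
    (Y : Matrix m m ℂ) (x y : m) : (Y * σ.permMatrix ℂ) x y = Y x (σ.symm y) := by
  simp [Matrix.mul_apply, Equiv.Perm.permMatrix, PEquiv.toMatrix_apply, ← Equiv.eq_symm_apply]

lemma permMatrix_mem_unitaryGroup (σ : Equiv.Perm n) :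
    σ.permMatrix ℂ ∈ Matrix.unitaryGroup n ℂ := by
  rw [Matrix.mem_unitaryGroup_iff', Matrix.star_eq_conjTranspose, Matrix.conjTranspose_permMatrix,
    ← Matrix.permMatrix_mul]
  simp

variable {Y : Matrix (n × n) (n × n) ℂ}

lemma apply_perm_of_commute
    (hY : ∀ V ∈ Matrix.unitaryGroup n ℂ, (V ⊗ₖ V) * Y = Y * (V ⊗ₖ V))
    (σ : Equiv.Perm n) (i j k l : n) :
    Y (σ i, σ j) (σ k, σ l) = Y (i, j) (k, l) := by
  have h := congrFun (congrFun (hY _ (permMatrix_mem_unitaryGroup σ)) (i, j)) (σ k, σ l)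
  rw [permMatrix_kronecker_permMatrix, permMatrix_mul_apply, mul_permMatrix_apply] at h
  simpa using h

/-- Invariance under the unitary that multiplies one basis vector by the phase `i`. Comparing the
powers of `i` on both sides leaves only the entries that conserve the pair of labels. -/
lemma eq_or_swap_of_commute
    (hY : ∀ V ∈ Matrix.unitaryGroup n ℂ, (V ⊗ₖ V) * Y = Y * (V ⊗ₖ V))
    {i j k l : n} (h0 : Y (i, j) (k, l) ≠ 0) :
    (i = k ∧ j = l) ∨ (i = l ∧ j = k) := by
  have key : ∀ t : n, (if i = t then Complex.I else 1) * (if j = t then Complex.I else 1) =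
      (if k = t then Complex.I else 1) * (if l = t then Complex.I else 1) := by
    intro t
    set d : n → ℂ := fun m => if m = t then Complex.I else 1
    have hd : Matrix.diagonal d ∈ Matrix.unitaryGroup n ℂ := by
      rw [Matrix.mem_unitaryGroup_iff', Matrix.star_eq_conjTranspose,
        Matrix.diagonal_conjTranspose, Matrix.diagonal_mul_diagonal, ← Matrix.diagonal_one]
      congr 1
      ext m
      by_cases hm : m = t <;> simp [d, hm]
    have h := congrFun (congrFun (hY _ hd) (i, j)) (k, l)
    rw [Matrix.diagonal_kronecker_diagonal, Matrix.diagonal_mul, Matrix.mul_diagonal,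
      mul_comm] at h
    exact mul_left_cancel₀ h0 h
  have h1 : (-1 : ℂ) ≠ Complex.I := fun h => by simpa using congrArg Complex.re h
  have h2 : (-1 : ℂ) ≠ 1 := by norm_num
  have h3 : Complex.I ≠ 1 := fun h => by simpa using congrArg Complex.re h
  have hi := key i
  have hj := key j
  by_cases hij : i = j
  · subst hij
    rw [if_pos rfl, Complex.I_mul_I] at hi
    split_ifs at hi with h4 h5 h5
    · exact Or.inl ⟨h4.symm, h5.symm⟩
    all_goals simp_all
  · rw [if_pos rfl, if_neg (Ne.symm hij)] at hi
    rw [if_pos rfl, if_neg hij] at hj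
    split_ifs at hi with h4 h5 h5
    · rw [Complex.I_mul_I, mul_one] at hi
      exact absurd hi.symm h1
    · rw [if_neg (fun h => hij (h4.symm.trans h))] at hj
      split_ifs at hj with h6
      · exact Or.inl ⟨h4.symm, h6.symm⟩
      · simp only [mul_one, one_mul] at hj
        exact absurd hj h3
    · rw [if_neg (fun h => hij (h5.symm.trans h))] at hj
      split_ifs at hj with h6
      · exact Or.inr ⟨h5.symm, h6.symm⟩
      · simp only [mul_one, one_mul] at hj
        exact absurd hj h3
    · simp only [mul_one] at hi
      exact absurd hi h3

/-- For the transposition `P` of `i` and `j`, the operator `((1 + i) + (1 - i) P) / 2` is unitary.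
Since `Y` commutes with its second tensor power and with `P ⊗ P`, it commutes with
`P ⊗ 1 + 1 ⊗ P`. -/
lemma diag_eq_add_of_commute
    (hY : ∀ V ∈ Matrix.unitaryGroup n ℂ, (V ⊗ₖ V) * Y = Y * (V ⊗ₖ V))
    {i j : n} (hij : i ≠ j) :
    Y (i, i) (i, i) = Y (i, j) (i, j) + Y (j, i) (i, j) := by
  set P : Matrix n n ℂ := (Equiv.swap i j).permMatrix ℂ with hP
  have hPP : P * P = 1 := by
    rw [hP, ← Matrix.permMatrix_mul]; simp
  have hPs : star P = P := by
    rw [hP, Matrix.star_eq_conjTranspose, Matrix.conjTranspose_permMatrix]; simp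
  set a : ℂ := (1 + Complex.I) / 2 with ha
  set b : ℂ := (1 - Complex.I) / 2 with hb
  have hI := Complex.I_mul_I
  have hV : a • (1 : Matrix n n ℂ) + b • P ∈ Matrix.unitaryGroup n ℂ := by
    have h1 : star a = b := by
      rw [ha, hb]; apply Complex.ext <;> simp
    have h2 : star b = a := by rw [← h1, star_star]
    have h3 : b * b + a * a = 0 := by rw [ha, hb]; linear_combination (1 / 2) * hI
    have h4 : b * a + a * b = 1 := by rw [ha, hb]; linear_combination (-1 / 2) * hI
    rw [Matrix.mem_unitaryGroup_iff', star_add, star_smul, star_smul, hPs, star_one, h1, h2]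
    simp only [add_mul, mul_add, smul_mul_smul_comm, one_mul, mul_one, hPP]
    calc _ = (b * a + a * b) • (1 : Matrix n n ℂ) + (b * b + a * a) • P := by
            simp only [add_smul]; abel
      _ = 1 := by rw [h3, h4]; simp
  have hab : a * b ≠ 0 := by
    have : a * b = 1 / 2 := by rw [ha, hb]; linear_combination (-1 / 4) * hI
    rw [this]; norm_num
  have h1 := hY _ hV
  have h2 := hY _ (permMatrix_mem_unitaryGroup (Equiv.swap i j))
  rw [← hP] at h2
  simp only [Matrix.add_kronecker, Matrix.kronecker_add, Matrix.smul_kronecker,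
    Matrix.kronecker_smul, add_mul, mul_add, Matrix.smul_mul, Matrix.mul_smul, h2,
    Matrix.one_kronecker_one, one_mul, mul_one] at h1
  have h3 : (a * b) • ((P ⊗ₖ (1 : Matrix n n ℂ)) * Y + ((1 : Matrix n n ℂ) ⊗ₖ P) * Y) =
      (a * b) • (Y * (P ⊗ₖ (1 : Matrix n n ℂ)) + Y * ((1 : Matrix n n ℂ) ⊗ₖ P)) := by
    rw [← sub_eq_zero, ← sub_eq_zero.mpr h1]
    module
  have h4 := congrFun (congrFun (smul_right_injective _ hab h3) (i, i)) (i, j)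
  have hl : ∀ x y z w : n, ((P ⊗ₖ (1 : Matrix n n ℂ)) * Y) (x, y) (z, w) =
      Y (Equiv.swap i j x, y) (z, w) := by
    intro x y z w
    simp [Matrix.mul_apply, Fintype.sum_prod_type, hP, Equiv.Perm.permMatrix,
      PEquiv.toMatrix_apply, Matrix.one_apply]
  have hl' : ∀ x y z w : n, (((1 : Matrix n n ℂ) ⊗ₖ P) * Y) (x, y) (z, w) =
      Y (x, Equiv.swap i j y) (z, w) := by
    intro x y z w
    simp [Matrix.mul_apply, Fintype.sum_prod_type, hP, Equiv.Perm.permMatrix,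
      PEquiv.toMatrix_apply, Matrix.one_apply]
  have hsw : ∀ x y : n, Equiv.swap i j x = y ↔ x = Equiv.swap i j y := by
    intro x y
    rw [← Equiv.symm_apply_eq, Equiv.symm_swap, eq_comm]
  have hr : ∀ x y z w : n, (Y * (P ⊗ₖ (1 : Matrix n n ℂ))) (x, y) (z, w) =
      Y (x, y) (Equiv.swap i j z, w) := by
    intro x y z w
    simp [Matrix.mul_apply, Fintype.sum_prod_type, hP, Equiv.Perm.permMatrix,
      PEquiv.toMatrix_apply, Matrix.one_apply, hsw]
  have hr' : ∀ x y z w : n, (Y * ((1 : Matrix n n ℂ) ⊗ₖ P)) (x, y) (z, w) =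
      Y (x, y) (z, Equiv.swap i j w) := by
    intro x y z w
    simp [Matrix.mul_apply, Fintype.sum_prod_type, hP, Equiv.Perm.permMatrix,
      PEquiv.toMatrix_apply, Matrix.one_apply, hsw]
  rw [Matrix.add_apply, Matrix.add_apply, hl, hl', hr, hr', Equiv.swap_apply_left,
    Equiv.swap_apply_right] at h4
  have h5 : Y (i, i) (j, j) = 0 := by
    by_contra h
    rcases eq_or_swap_of_commute hY h with h | h <;> exact hij h.1
  rw [h5, zero_add] at h4
  rw [← h4, add_comm]

/-- Schur–Weyl duality for two copies: an operator commuting with all `V ⊗ V` is a combination of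
the identity and the swap. -/
theorem exists_eq_smul_one_add_smul_swap [Nontrivial n]
    (hY : ∀ V ∈ Matrix.unitaryGroup n ℂ, (V ⊗ₖ V) * Y = Y * (V ⊗ₖ V)) :
    ∃ α β : ℂ, Y = α • (1 : Matrix (n × n) (n × n) ℂ) + β • swapMatrix n := by
  obtain ⟨s, t, hst⟩ := exists_pair_ne n
  have hperm : ∀ i j : n, i ≠ j → ∃ σ : Equiv.Perm n, σ s = i ∧ σ t = j := by
    intro i j hij
    refine ⟨(Equiv.swap s i).trans (Equiv.swap (Equiv.swap s i t) j), ?_, ?_⟩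
    · have h1 : i ≠ Equiv.swap s i t := by
        intro h
        have := congrArg (Equiv.swap s i) h
        rw [Equiv.swap_apply_right, Equiv.swap_apply_self] at this
        exact hst this
      simp [Equiv.swap_apply_of_ne_of_ne h1 hij]
    · simp
  refine ⟨Y (s, t) (s, t), Y (t, s) (s, t), ?_⟩
  ext ⟨i, j⟩ ⟨k, l⟩
  rw [Matrix.add_apply, Matrix.smul_apply, Matrix.smul_apply, swapMatrix_apply, Matrix.one_apply]
  simp only [Prod.mk.injEq, smul_eq_mul, mul_ite, mul_one, mul_zero]
  by_cases h : (i = k ∧ j = l) ∨ (i = l ∧ j = k)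
  · by_cases hij : i = j
    · subst hij
      have hkl : i = k ∧ i = l := by rcases h with h | h <;> simp [h.1.symm, h.2.symm]
      obtain ⟨rfl, rfl⟩ := hkl
      obtain ⟨m, hm⟩ := exists_ne i
      rw [diag_eq_add_of_commute hY hm.symm]
      obtain ⟨σ, rfl, rfl⟩ := hperm i m hm.symm
      simp [apply_perm_of_commute hY]
    · obtain ⟨σ, rfl, rfl⟩ := hperm i j hij
      rcases h with ⟨rfl, rfl⟩ | ⟨rfl, rfl⟩
      · simp [apply_perm_of_commute hY, hst]
      · have := apply_perm_of_commute hY ((Equiv.swap s t).trans σ) t s s t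
        simp at this
        simp [this, hst]
  · have h0 : Y (i, j) (k, l) = 0 := by
      by_contra h0
      exact h (eq_or_swap_of_commute hY h0)
    rw [not_or] at h
    simp [h0, h.1, h.2]

end Commutant

/-! ### The second moment of the Haar measure -/

section Haar

variable {n : Type} [Fintype n] [DecidableEq n]

instance haarUnitary_isHaarMeasure : (haarUnitary n).IsHaarMeasure := by
  unfold haarUnitary; infer_instance

instance haarUnitary_isProbabilityMeasure : IsProbabilityMeasure (haarUnitary n) :=
  ⟨by simpa [haarUnitary] using
    Measure.haarMeasure_self (K₀ := (⊤ : TopologicalSpace.PositiveCompacts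
      (Matrix.unitaryGroup n ℂ)))⟩

/-- Compact groups are unimodular. -/
instance haarUnitary_isMulRightInvariant : (haarUnitary n).IsMulRightInvariant := by
  refine ⟨fun g => ?_⟩
  have : IsProbabilityMeasure ((haarUnitary n).map (· * g)) :=
    Measure.isProbabilityMeasure_map (measurable_mul_const g).aemeasurable
  exact Measure.isHaarMeasure_eq_of_isProbabilityMeasure _ _

variable {b r : Type}

/-- The permutation of `n × n ≃ (b × r) × (b × r)` exchanging the two copies of `b`. -/
def partialSwap (e : n ≃ b × r) : Equiv.Perm (n × n) where
  toFun x := (e.symm ((e x.2).1, (e x.1).2), e.symm ((e x.1).1, (e x.2).2))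
  invFun x := (e.symm ((e x.2).1, (e x.1).2), e.symm ((e x.1).1, (e x.2).2))
  left_inv x := by simp
  right_inv x := by simp

/-- The operator exchanging the two copies of `b`, conjugated by `Z ⊗ Z`. -/
def twirled (e : n ≃ b × r) {m : Type} (Z : Matrix n m ℂ) : Matrix (m × m) (m × m) ℂ :=
  (Z ⊗ₖ Z)ᴴ * Equiv.Perm.permMatrix ℂ (partialSwap e) * (Z ⊗ₖ Z)

lemma twirled_mul (e : n ≃ b × r) {m k : Type} [Fintype m] (Z : Matrix n m ℂ)
    (W : Matrix m k ℂ) : twirled e (Z * W) = (W ⊗ₖ W)ᴴ * twirled e Z * (W ⊗ₖ W) := by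
  simp only [twirled, Matrix.mul_kronecker_mul, Matrix.conjTranspose_mul, Matrix.mul_assoc]

lemma continuous_twirled_apply (e : n ≃ b × r) {m : Type} (J : Matrix n m ℂ) (x y : m × m) :
    Continuous fun U : Matrix.unitaryGroup n ℂ => twirled e ((U : Matrix n n ℂ) * J) x y := by
  have h : Continuous fun U : Matrix.unitaryGroup n ℂ => (U : Matrix n n ℂ) * J := by fun_prop
  have h2 : ∀ i j, Continuous fun U : Matrix.unitaryGroup n ℂ => ((U : Matrix n n ℂ) * J) i j :=
    fun i j => h.matrix_elem i j
  simp only [twirled, Matrix.mul_apply (M := _ * _), Matrix.mul_apply (M := (_)ᴴ),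
    Matrix.conjTranspose_apply, Matrix.kroneckerMap_apply]
  fun_prop

lemma integrable_of_continuous {E : Type} [NormedAddCommGroup E]
    {f : Matrix.unitaryGroup n ℂ → E} (hf : Continuous f) :
    Integrable f (haarUnitary n) :=
  hf.integrable_of_hasCompactSupport (HasCompactSupport.of_compactSpace f)

/-- The Haar average of `twirled`. -/
noncomputable def twirlMean (e : n ≃ b × r) : Matrix (n × n) (n × n) ℂ :=
  Matrix.of fun x y => ∫ U, twirled e (U : Matrix n n ℂ) x y ∂haarUnitary n

lemma integrable_twirled_apply (e : n ≃ b × r) (x y : n × n) :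
    Integrable (fun U : Matrix.unitaryGroup n ℂ => twirled e (U : Matrix n n ℂ) x y)
      (haarUnitary n) := by
  refine integrable_of_continuous ?_
  simpa using continuous_twirled_apply e (1 : Matrix n n ℂ) x y

lemma integral_conj_twirled (e : n ≃ b × r) {m k : Type}
    (A : Matrix m (n × n) ℂ) (C : Matrix (n × n) k ℂ) (x : m) (y : k) :
    ∫ U, (A * twirled e (U : Matrix n n ℂ) * C) x y ∂haarUnitary n =
      (A * twirlMean e * C) x y := by
  simp only [Matrix.mul_apply (M := _ * _), Matrix.mul_apply (M := A)]
  rw [integral_finsetSum]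
  · refine Finset.sum_congr rfl fun j _ => ?_
    rw [integral_mul_const, integral_finsetSum]
    · congr 1
      refine Finset.sum_congr rfl fun i _ => ?_
      rw [integral_const_mul]; rfl
    · exact fun i _ => (integrable_twirled_apply e i j).const_mul _
  · exact fun j _ => (integrable_finsetSum _ fun i _ =>
      (integrable_twirled_apply e i j).const_mul _).mul_const _

lemma twirlMean_commute (e : n ≃ b × r) (V : Matrix n n ℂ) (hV : V ∈ Matrix.unitaryGroup n ℂ) :
    (V ⊗ₖ V) * twirlMean e = twirlMean e * (V ⊗ₖ V) := by
  have h1 : (V ⊗ₖ V)ᴴ * twirlMean e * (V ⊗ₖ V) = twirlMean e := by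
    ext x y
    rw [← integral_conj_twirled]
    simp_rw [← twirled_mul]
    exact integral_mul_right_eq_self (μ := haarUnitary n)
      (fun U => twirled e (U : Matrix n n ℂ) x y) ⟨V, hV⟩
  have h2 : (V ⊗ₖ V) * (V ⊗ₖ V)ᴴ = 1 := by
    rw [Matrix.conjTranspose_kronecker, ← Matrix.mul_kronecker_mul, ← Matrix.star_eq_conjTranspose,
      Matrix.mem_unitaryGroup_iff.mp hV, Matrix.one_kronecker_one]
  calc (V ⊗ₖ V) * twirlMean e = (V ⊗ₖ V) * ((V ⊗ₖ V)ᴴ * twirlMean e * (V ⊗ₖ V)) := by rw [h1]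
    _ = ((V ⊗ₖ V) * (V ⊗ₖ V)ᴴ) * (twirlMean e * (V ⊗ₖ V)) := by simp only [Matrix.mul_assoc]
    _ = _ := by rw [h2, one_mul]

end Haar

section SecondMoment

lemma trace_permMatrix {m : Type} [Fintype m] [DecidableEq m] (σ : Equiv.Perm m) :
    (σ.permMatrix ℂ).trace = ∑ x, if σ x = x then 1 else 0 := by
  simp [Matrix.trace, Equiv.Perm.permMatrix, PEquiv.toMatrix_apply]

lemma trace_swapMatrix (m : Type) [Fintype m] [DecidableEq m] :
    (swapMatrix m).trace = Fintype.card m := by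
  simp [Matrix.trace, swapMatrix_apply, Fintype.sum_prod_type, ite_and]

lemma swapMatrix_mul_swapMatrix (m : Type) [Fintype m] [DecidableEq m] :
    swapMatrix m * swapMatrix m = 1 := by
  ext x y
  rw [swapMatrix, permMatrix_mul_apply, ← swapMatrix, swapMatrix_apply, Matrix.one_apply]
  simp [Prod.ext_iff, and_comm]

lemma swapMatrix_mul_kronecker {n m : Type} [Fintype n] [DecidableEq n] [Fintype m]
    [DecidableEq m] (J : Matrix n m ℂ) :
    swapMatrix n * (J ⊗ₖ J) = (J ⊗ₖ J) * swapMatrix m := by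
  ext ⟨x, y⟩ ⟨z, w⟩
  simp [Matrix.mul_apply, swapMatrix_apply, Fintype.sum_prod_type, ite_and, mul_comm]

variable {n : Type} [Fintype n] {b r : Type} [Fintype b] [Fintype r]

lemma sum_prod_equiv (e : n ≃ b × r) {E : Type} [AddCommMonoid E] (f : n × n → E) :
    ∑ x, f x = ∑ b₁, ∑ r₁, ∑ b₂, ∑ r₂, f (e.symm (b₁, r₁), e.symm (b₂, r₂)) := by
  rw [← (e.symm.prodCongr e.symm).sum_comp f]
  simp [Fintype.sum_prod_type]

variable [DecidableEq n]

lemma trace_twirled [DecidableEq b] (e : n ≃ b × r) (U : Matrix n n ℂ)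
    (hU : U ∈ Matrix.unitaryGroup n ℂ) :
    (twirled e U).trace = Fintype.card b * (Fintype.card r : ℂ) ^ 2 := by
  have h2 : (U ⊗ₖ U) * (U ⊗ₖ U)ᴴ = 1 := by
    rw [Matrix.conjTranspose_kronecker, ← Matrix.mul_kronecker_mul, ← Matrix.star_eq_conjTranspose,
      Matrix.mem_unitaryGroup_iff.mp hU, Matrix.one_kronecker_one]
  rw [twirled, Matrix.trace_mul_comm, ← Matrix.mul_assoc, h2, one_mul, trace_permMatrix,
    sum_prod_equiv e]
  simp [partialSwap, Prod.ext_iff, Finset.sum_ite_eq, eq_comm, pow_two]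

lemma trace_swapMatrix_mul_twirled [DecidableEq r] (e : n ≃ b × r) (U : Matrix n n ℂ)
    (hU : U ∈ Matrix.unitaryGroup n ℂ) :
    (swapMatrix n * twirled e U).trace = (Fintype.card b : ℂ) ^ 2 * Fintype.card r := by
  have h2 : (U ⊗ₖ U) * (U ⊗ₖ U)ᴴ = 1 := by
    rw [Matrix.conjTranspose_kronecker, ← Matrix.mul_kronecker_mul, ← Matrix.star_eq_conjTranspose,
      Matrix.mem_unitaryGroup_iff.mp hU, Matrix.one_kronecker_one]
  rw [twirled, Matrix.conjTranspose_kronecker, ← Matrix.mul_assoc, ← Matrix.mul_assoc,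
    swapMatrix_mul_kronecker, Matrix.trace_mul_comm, ← Matrix.mul_assoc, ← Matrix.mul_assoc,
    ← Matrix.conjTranspose_kronecker, h2, one_mul]
  simp only [Matrix.trace, Matrix.diag_apply, swapMatrix, permMatrix_mul_apply]
  rw [sum_prod_equiv e]
  simp [partialSwap, Prod.ext_iff, Finset.sum_ite_eq, eq_comm, pow_two, Equiv.Perm.permMatrix,
    PEquiv.toMatrix_apply]
  ring

/-- The Haar average of the partial swap; the two coefficients follow from the traces of the
average and of its product with the swap. -/
lemma exists_twirlMean_eq [DecidableEq b] [DecidableEq r] [Nontrivial n] (e : n ≃ b × r) :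
    ∃ α β : ℝ,
    twirlMean e = (α : ℂ) • (1 : Matrix (n × n) (n × n) ℂ) + (β : ℂ) • swapMatrix n ∧
    α ≤ (Fintype.card b : ℝ)⁻¹ ∧ β ≤ (Fintype.card r : ℝ)⁻¹ := by
  obtain ⟨α, β, h⟩ := exists_eq_smul_one_add_smul_swap (twirlMean_commute e)
  have h1 : (twirlMean e).trace = Fintype.card b * (Fintype.card r : ℂ) ^ 2 := by
    have : (twirlMean e).trace = ∫ U, (twirled e (U : Matrix n n ℂ)).trace ∂haarUnitary n := by
      simp only [Matrix.trace, Matrix.diag_apply]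
      rw [integral_finsetSum _ fun x _ => integrable_twirled_apply e x x]
      rfl
    rw [this]
    simp [fun U : Matrix.unitaryGroup n ℂ => trace_twirled e U.1 U.2]
  have h2 : (swapMatrix n * twirlMean e).trace = (Fintype.card b : ℂ) ^ 2 * Fintype.card r := by
    have : (swapMatrix n * twirlMean e).trace =
        ∫ U, (swapMatrix n * twirled e (U : Matrix n n ℂ)).trace ∂haarUnitary n := by
      simp only [Matrix.trace, Matrix.diag_apply, swapMatrix, permMatrix_mul_apply]
      rw [integral_finsetSum _ fun x _ => integrable_twirled_apply e _ x]
      rfl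
    rw [this]
    simp [fun U : Matrix.unitaryGroup n ℂ => trace_swapMatrix_mul_twirled e U.1 U.2]
  have hcard : Fintype.card n = Fintype.card b * Fintype.card r := by
    rw [Fintype.card_congr e, Fintype.card_prod]
  have hn : 1 < Fintype.card n := Fintype.one_lt_card
  have hb : 1 ≤ Fintype.card b := by
    rcases Nat.eq_zero_or_pos (Fintype.card b) with h | h
    · simp [hcard, h] at hn
    · exact h
  have hr : 1 ≤ Fintype.card r := by
    rcases Nat.eq_zero_or_pos (Fintype.card r) with h | h
    · simp [hcard, h] at hn
    · exact h
  rw [h, Matrix.trace_add, Matrix.trace_smul, Matrix.trace_smul, Matrix.trace_one,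
    trace_swapMatrix, Fintype.card_prod] at h1
  rw [h, mul_add, Matrix.mul_smul, Matrix.mul_smul, swapMatrix_mul_swapMatrix, mul_one,
    Matrix.trace_add, Matrix.trace_smul, Matrix.trace_smul, Matrix.trace_one,
    trace_swapMatrix, Fintype.card_prod] at h2
  rw [hcard] at h1 h2 hn
  push_cast [smul_eq_mul] at h1 h2
  generalize Fintype.card b = p at *
  generalize Fintype.card r = q at *
  have hp0 : (p : ℂ) ≠ 0 := by exact_mod_cast (by omega : p ≠ 0)
  have hq0 : (q : ℂ) ≠ 0 := by exact_mod_cast (by omega : q ≠ 0)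
  have hp1 : (1 : ℝ) ≤ p := by exact_mod_cast hb
  have hq1 : (1 : ℝ) ≤ q := by exact_mod_cast hr
  have hpq : (1 : ℝ) < p * q := by exact_mod_cast hn
  have hD : (0 : ℝ) < ((p : ℝ) * q) ^ 2 - 1 := by nlinarith
  have hDC : (((p : ℝ) * q) ^ 2 - 1 : ℂ) ≠ 0 := by exact_mod_cast hD.ne'
  have e1 : α * (p * q) + β = q := by
    apply mul_left_cancel₀ (mul_ne_zero hp0 hq0)
    linear_combination h1
  have e2 : α + β * (p * q) = p := by
    apply mul_left_cancel₀ (mul_ne_zero hp0 hq0)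
    linear_combination h2
  have ha : α = (((p * q * q - p) / ((p * q) ^ 2 - 1) : ℝ) : ℂ) := by
    push_cast at hDC ⊢
    rw [eq_div_iff hDC]
    linear_combination (p * q : ℂ) * e1 - e2
  have hb' : β = (((p * q * p - q) / ((p * q) ^ 2 - 1) : ℝ) : ℂ) := by
    push_cast at hDC ⊢
    rw [eq_div_iff hDC]
    linear_combination (p * q : ℂ) * e2 - e1
  refine ⟨_, _, by rw [h, ha, hb'], ?_, ?_⟩
  · rw [div_le_iff₀ hD, ← div_eq_inv_mul, le_div_iff₀ (by positivity)]
    nlinarith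
  · rw [div_le_iff₀ hD, ← div_eq_inv_mul, le_div_iff₀ (by positivity)]
    nlinarith


/-! ### Decoupling -/

/-- The squared Hilbert–Schmidt norm. -/
noncomputable def frobSq {m k : Type} [Fintype m] [Fintype k] (A : Matrix m k ℂ) : ℝ :=
  ∑ i, ∑ j, ‖A i j‖ ^ 2

lemma frobSq_nonneg {m k : Type} [Fintype m] [Fintype k] (A : Matrix m k ℂ) : 0 ≤ frobSq A :=
  Finset.sum_nonneg fun _ _ => Finset.sum_nonneg fun _ _ => sq_nonneg _

lemma trace_conjTranspose_mul_self {m k : Type} [Fintype m] [Fintype k] (A : Matrix m k ℂ) :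
    (Aᴴ * A).trace = frobSq A := by
  simp only [frobSq, Matrix.trace, Matrix.diag_apply, Matrix.mul_apply,
    Matrix.conjTranspose_apply, Complex.ofReal_sum, Complex.ofReal_pow]
  rw [Finset.sum_comm]
  simp [Complex.conj_mul']

/-- The Gram matrix of the vectors `|B|^(-1/2) ∑ β, ⟨k|_b Z_{(q, β)} ⊗ |w_β⟩`, labelled by `(k, q)`,
where `Z_v` are the columns of `Z`, `e` splits off the subsystem `b`, and `w` is any orthonormal
family. Up to a transposition and the factor `|I|`, it is the joint state of `b` and a reference
system that is maximally entangled with `I`. -/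
noncomputable def gram {B I : Type} [Fintype B] (e : n ≃ b × r) (Z : Matrix n (I × B) ℂ) :
    Matrix (b × I) (b × I) ℂ :=
  Matrix.of fun x y => (Fintype.card B : ℂ)⁻¹ *
    ∑ k, ∑ β, star (Z (e.symm (x.1, k)) (x.2, β)) * Z (e.symm (y.1, k)) (y.2, β)

section Gram

variable {B I : Type} [Fintype B] [Fintype I]

lemma twirled_apply (e : n ≃ b × r) {m : Type} (Z : Matrix n m ℂ) (u v w z : m) :
    twirled e Z (u, v) (w, z) = ∑ b₁, ∑ r₁, ∑ b₂, ∑ r₂,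
      star (Z (e.symm (b₁, r₁)) u) * star (Z (e.symm (b₂, r₂)) v) *
        (Z (e.symm (b₂, r₁)) w * Z (e.symm (b₁, r₂)) z) := by
  have h : ∀ x, (Equiv.Perm.permMatrix ℂ (partialSwap e) * (Z ⊗ₖ Z)) x (w, z) =
      Z (partialSwap e x).1 w * Z (partialSwap e x).2 z := by
    intro x
    rw [permMatrix_mul_apply]; rfl
  rw [twirled, Matrix.mul_assoc, Matrix.mul_apply, sum_prod_equiv e]
  simp only [h, Matrix.conjTranspose_apply, Matrix.kroneckerMap_apply, star_mul']
  simp only [partialSwap, Equiv.coe_fn_mk, Equiv.apply_symm_apply]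

lemma sum_reorder {b I r B : Type} [Fintype b] [Fintype I] [Fintype r] [Fintype B]
    (f : b → I → b → I → r → B → r → B → ℂ) :
    ∑ b₁, ∑ q, ∑ b₂, ∑ q', ∑ r₁, ∑ β, ∑ r₂, ∑ β', f b₁ q b₂ q' r₁ β r₂ β' =
      ∑ q, ∑ q', ∑ β, ∑ β', ∑ b₁, ∑ r₁, ∑ b₂, ∑ r₂, f b₁ q b₂ q' r₁ β r₂ β' := by
  simp only [← Fintype.sum_prod_type']
  exact Fintype.sum_equiv
    ⟨fun (b₁, q, b₂, q', r₁, β, r₂, β') => (q, q', β, β', b₁, r₁, b₂, r₂),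
      fun (q, q', β, β', b₁, r₁, b₂, r₂) => (b₁, q, b₂, q', r₁, β, r₂, β'),
      fun _ => rfl, fun _ => rfl⟩ _ _ fun _ => rfl

lemma frobSq_gram (e : n ≃ b × r) (Z : Matrix n (I × B) ℂ) :
    (frobSq (gram e Z) : ℂ) = ((Fintype.card B : ℂ)⁻¹) ^ 2 *
      ∑ q, ∑ q', ∑ β, ∑ β', twirled e Z ((q, β), (q', β')) ((q', β), (q, β')) := by
  simp only [twirled_apply]
  rw [← sum_reorder fun b₁ q b₂ q' r₁ β r₂ β' =>
    star (Z (e.symm (b₁, r₁)) (q, β)) * star (Z (e.symm (b₂, r₂)) (q', β')) *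
      (Z (e.symm (b₂, r₁)) (q', β) * Z (e.symm (b₁, r₂)) (q, β'))]
  simp only [frobSq, Fintype.sum_prod_type, Complex.ofReal_sum, Finset.mul_sum]
  refine Finset.sum_congr rfl fun b₁ _ => Finset.sum_congr rfl fun q _ =>
    Finset.sum_congr rfl fun b₂ _ => Finset.sum_congr rfl fun q' _ => ?_
  rw [Complex.ofReal_pow, ← Complex.conj_mul']
  simp only [gram, Matrix.of_apply, map_mul, map_sum, map_inv₀, map_natCast, Finset.mul_sum,
    Finset.sum_mul, starRingEnd_apply, star_star]
  refine Finset.sum_congr rfl fun r₁ _ => Finset.sum_congr rfl fun β _ =>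
    Finset.sum_congr rfl fun r₂ _ => Finset.sum_congr rfl fun β' _ => ?_
  ring

variable [DecidableEq B] [DecidableEq I]

lemma trace_gram {n : Type} [Fintype n] (e : n ≃ b × r) [Nonempty B]
    (Z : Matrix n (I × B) ℂ) (hZ : Zᴴ * Z = 1) :
    (gram e Z).trace = Fintype.card I := by
  have h : ∀ v, ∑ x, star (Z x v) * Z x v = 1 := by
    intro v
    have := congrFun (congrFun hZ v) v
    simpa [Matrix.mul_apply] using this
  have h2 : (gram e Z).trace =
      (Fintype.card B : ℂ)⁻¹ * ∑ v : I × B, ∑ x, star (Z x v) * Z x v := by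
    rw [Finset.sum_comm, ← e.symm.sum_comp, Fintype.sum_prod_type]
    simp only [Matrix.trace, Matrix.diag_apply, gram, Matrix.of_apply, Fintype.sum_prod_type]
    rw [Finset.mul_sum]
    refine Finset.sum_congr rfl fun x _ => ?_
    rw [← Finset.mul_sum, Finset.sum_comm]
  rw [h2, Finset.sum_congr rfl fun v _ => h v]
  have : (Fintype.card B : ℂ) ≠ 0 := by simp
  simp
  field_simp

lemma frobSq_sub_smul_one {m : Type} [Fintype m] [DecidableEq m] (G : Matrix m m ℂ) (c : ℝ) :
    frobSq (G - (c : ℂ) • (1 : Matrix m m ℂ)) =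
      frobSq G - 2 * c * G.trace.re + c ^ 2 * Fintype.card m := by
  apply Complex.ofReal_injective
  have h : ((G.trace.re : ℝ) : ℂ) = (G.trace + star G.trace) / 2 := by
    rw [Complex.re_eq_add_conj]; rfl
  push_cast
  rw [← trace_conjTranspose_mul_self, ← trace_conjTranspose_mul_self, h,
    ← Matrix.trace_conjTranspose, Matrix.conjTranspose_sub, Matrix.conjTranspose_smul]
  simp only [sub_mul, mul_sub, Matrix.trace_sub, Matrix.smul_mul, Matrix.mul_smul,
    Matrix.trace_smul, smul_eq_mul, Matrix.conjTranspose_one, one_mul, mul_one, Matrix.trace_one]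
  simp
  ring

/-- The Haar average of `twirled e (U * J)` for an isometry `J`. -/
lemma integral_twirled_mul [DecidableEq b] [DecidableEq r] [Nontrivial n] (e : n ≃ b × r)
    {m : Type} [Fintype m] [DecidableEq m]
    (J : Matrix n m ℂ) (hJ : Jᴴ * J = 1) : ∃ α β : ℝ,
    α ≤ (Fintype.card b : ℝ)⁻¹ ∧ β ≤ (Fintype.card r : ℝ)⁻¹ ∧
    ∀ x y, ∫ U, twirled e ((U : Matrix n n ℂ) * J) x y ∂haarUnitary n =
      ((α : ℂ) • (1 : Matrix (m × m) (m × m) ℂ) + (β : ℂ) • swapMatrix m) x y := by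
  obtain ⟨α, β, h, hα, hβ⟩ := exists_twirlMean_eq e
  refine ⟨α, β, hα, hβ, fun x y => ?_⟩
  have hJJ : (J ⊗ₖ J)ᴴ * (J ⊗ₖ J) = 1 := by
    rw [Matrix.conjTranspose_kronecker, ← Matrix.mul_kronecker_mul, hJ, Matrix.one_kronecker_one]
  simp_rw [twirled_mul]
  rw [integral_conj_twirled, h, Matrix.mul_add, Matrix.mul_smul, Matrix.mul_smul, Matrix.add_mul,
    Matrix.smul_mul, Matrix.smul_mul, Matrix.mul_one, hJJ, Matrix.mul_assoc,
    swapMatrix_mul_kronecker, ← Matrix.mul_assoc, hJJ, Matrix.one_mul]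

/-- The decoupling estimate: the average deviation of the Gram matrix from a multiple of the
identity. -/
theorem integral_frobSq_gram_le [DecidableEq b] [DecidableEq r] [Nontrivial n] [Nonempty B]
    (e : n ≃ b × r)
    (J : Matrix n (I × B) ℂ) (hJ : Jᴴ * J = 1) :
    Integrable (fun U : Matrix.unitaryGroup n ℂ =>
      frobSq (gram e ((U : Matrix n n ℂ) * J) - (((Fintype.card b : ℝ)⁻¹ : ℝ) : ℂ) • 1))
      (haarUnitary n) ∧
    ∫ U, frobSq (gram e ((U : Matrix n n ℂ) * J) - (((Fintype.card b : ℝ)⁻¹ : ℝ) : ℂ) • 1)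
      ∂haarUnitary n ≤ (Fintype.card I : ℝ) ^ 2 / (Fintype.card B * Fintype.card r) := by
  have hb : (Fintype.card b : ℝ) ≠ 0 := by
    obtain ⟨x, _⟩ := exists_pair_ne n
    have : Nonempty b := ⟨(e x).1⟩
    simp
  have hB : (Fintype.card B : ℝ) ≠ 0 := by simp
  have hint : ∀ x y, Integrable (fun U : Matrix.unitaryGroup n ℂ =>
      twirled e ((U : Matrix n n ℂ) * J) x y) (haarUnitary n) := fun x y =>
    integrable_of_continuous (continuous_twirled_apply e J x y)
  have hf : ∀ U : Matrix.unitaryGroup n ℂ,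
      frobSq (gram e ((U : Matrix n n ℂ) * J) - (((Fintype.card b : ℝ)⁻¹ : ℝ) : ℂ) • 1) =
        frobSq (gram e ((U : Matrix n n ℂ) * J)) - Fintype.card I / Fintype.card b := by
    intro U
    have hZ : ((U : Matrix n n ℂ) * J)ᴴ * ((U : Matrix n n ℂ) * J) = 1 := by
      have := Matrix.mem_unitaryGroup_iff'.mp U.2
      rw [Matrix.star_eq_conjTranspose] at this
      rw [Matrix.conjTranspose_mul, Matrix.mul_assoc, ← Matrix.mul_assoc _ _ J, this,
        Matrix.one_mul, hJ]
    rw [frobSq_sub_smul_one, trace_gram e _ hZ, Complex.natCast_re, Fintype.card_prod]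
    push_cast
    field_simp
    ring
  have hG : Integrable (fun U : Matrix.unitaryGroup n ℂ =>
      (frobSq (gram e ((U : Matrix n n ℂ) * J)) : ℂ)) (haarUnitary n) := by
    simp only [frobSq_gram]
    exact (integrable_finsetSum _ fun q _ => integrable_finsetSum _ fun q' _ =>
      integrable_finsetSum _ fun β _ => integrable_finsetSum _ fun β' _ => hint _ _).const_mul _
  have hG' : Integrable (fun U : Matrix.unitaryGroup n ℂ =>
      frobSq (gram e ((U : Matrix n n ℂ) * J))) (haarUnitary n) := by
    simpa using hG.re
  simp only [hf]
  refine ⟨hG'.sub (integrable_const _), ?_⟩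
  rw [integral_sub hG' (integrable_const _)]
  obtain ⟨α, β, hα, hβ, h⟩ := integral_twirled_mul e J hJ
  have hval : ∫ U, frobSq (gram e ((U : Matrix n n ℂ) * J)) ∂haarUnitary n =
      α * Fintype.card I + β * (Fintype.card I) ^ 2 / Fintype.card B := by
    apply Complex.ofReal_injective
    rw [← integral_complex_ofReal]
    simp only [frobSq_gram]
    rw [integral_const_mul, integral_finsetSum _ fun q _ => integrable_finsetSum _ fun q' _ =>
      integrable_finsetSum _ fun β _ => integrable_finsetSum _ fun β' _ => hint _ _]
    have h2 : ∀ q : I, ∫ U, ∑ q' : I, ∑ β : B, ∑ β' : B,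
        twirled e ((U : Matrix n n ℂ) * J) ((q, β), (q', β')) ((q', β), (q, β')) ∂haarUnitary n =
        ∑ q' : I, ∑ β₁ : B, ∑ β' : B, ((if q = q' then (α : ℂ) else 0) +
          if β₁ = β' then (β : ℂ) else 0) := by
      intro q
      rw [integral_finsetSum _ fun q' _ => integrable_finsetSum _ fun β _ =>
        integrable_finsetSum _ fun β' _ => hint _ _]
      refine Finset.sum_congr rfl fun q' _ => ?_
      rw [integral_finsetSum _ fun β _ => integrable_finsetSum _ fun β' _ => hint _ _]
      refine Finset.sum_congr rfl fun β₁ _ => ?_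
      rw [integral_finsetSum _ fun β' _ => hint _ _]
      refine Finset.sum_congr rfl fun β' _ => ?_
      rw [h, Matrix.add_apply, Matrix.smul_apply, Matrix.smul_apply, swapMatrix_apply,
        Matrix.one_apply]
      simp [eq_comm]
    simp only [h2, Finset.sum_add_distrib, Finset.sum_const, Finset.sum_ite_eq, Finset.mem_univ,
      if_true, Finset.card_univ, nsmul_eq_mul, mul_ite, mul_zero]
    have hB' : (Fintype.card B : ℂ) ≠ 0 := by simp
    push_cast
    field_simp
  rw [hval, integral_const]
  simp only [probReal_univ, one_smul]
  have h1 : α * Fintype.card I ≤ Fintype.card I / Fintype.card b := by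
    rw [div_eq_inv_mul]
    exact mul_le_mul_of_nonneg_right hα (Nat.cast_nonneg _)
  have h2 : β * (Fintype.card I : ℝ) ^ 2 / Fintype.card B ≤
      (Fintype.card I : ℝ) ^ 2 / (Fintype.card B * Fintype.card r) := by
    calc β * (Fintype.card I : ℝ) ^ 2 / Fintype.card B ≤
        (Fintype.card r : ℝ)⁻¹ * (Fintype.card I : ℝ) ^ 2 / Fintype.card B := by gcongr
      _ = _ := by rw [mul_comm (Fintype.card B : ℝ), div_mul_eq_div_div, div_eq_inv_mul _
                    (Fintype.card r : ℝ)]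
  linarith

end Gram

end SecondMoment

/-! ### Approximate inversion of a near-isometry -/

section Decoder

lemma exists_eq_conjTranspose_mul_self {m : Type} [Fintype m] [DecidableEq m]
    {A : Matrix m m ℂ} (hA : A.PosSemidef) : ∃ F : Matrix m m ℂ, A = Fᴴ * F := by
  open scoped MatrixOrder Matrix.Norms.L2Operator in
  exact CStarAlgebra.nonneg_iff_eq_star_mul_self.mp hA.nonneg

variable {O m : Type} [Fintype O] [DecidableEq O] [Fintype m] [DecidableEq m]

/-- If the Gram matrix `G = Mᴴ M` is close to `c² 1`, then `M / c` is close to an isometry. With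
`N = M Mᴴ`, the contraction `P = 2 c (N + c²)⁻¹ M` approximates this isometry: it applies
`t ↦ 2 c t / (t² + c²)`, which is at most `1` with equality at `t = c`, to the singular values of
`M`. Its defect `1 - P Pᴴ` is the square of `C = 1 - 2 c² (N + c²)⁻¹`. -/
lemma exists_approximate_inverse (M : Matrix O m ℂ) {c : ℝ} (hc : 0 < c) :
    ∃ (P : Matrix O m ℂ) (C : Matrix O O ℂ), P * Pᴴ + Cᴴ * C = 1 ∧
      frobSq (Pᴴ * M - (c : ℂ) • 1) + frobSq (C * M) ≤
        frobSq (Mᴴ * M - ((c ^ 2 : ℝ) : ℂ) • 1) / c ^ 2 := by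
  set s : ℂ := ((c ^ 2 : ℝ) : ℂ) with hs
  have hcs : (c : ℂ) * c = s := by rw [hs]; push_cast; ring
  set X : Matrix O O ℂ := M * Mᴴ + s • 1 with hX
  have hXpos : X.PosDef := by
    refine Matrix.PosDef.posSemidef_add (Matrix.posSemidef_self_mul_conjTranspose M) ?_
    exact Matrix.PosDef.one.smul (by rw [hs]; exact_mod_cast (by positivity : (0 : ℝ) < c ^ 2))
  have hN : M * Mᴴ = X - s • 1 := by rw [hX]; abel
  set A := X⁻¹ with hA
  have hdet : IsUnit X.det := (Matrix.isUnit_iff_isUnit_det _).mp hXpos.isUnit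
  have hAX : A * X = 1 := Matrix.nonsing_inv_mul _ hdet
  have hXA : X * A = 1 := Matrix.mul_nonsing_inv _ hdet
  have hAH : Aᴴ = A := hXpos.inv.isHermitian
  have hPH : ((2 * c : ℂ) • (A * M))ᴴ = (2 * c : ℂ) • (Mᴴ * A) := by
    rw [Matrix.conjTranspose_smul, Matrix.conjTranspose_mul, hAH]; simp
  have hCH : (1 - (2 * s) • A)ᴴ = 1 - (2 * s) • A := by
    rw [Matrix.conjTranspose_sub, Matrix.conjTranspose_smul, hAH]; simp [hs]
  have hsum : ((2 * c : ℂ) • (A * M)) * ((2 * c : ℂ) • (A * M))ᴴ +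
      (1 - (2 * s) • A)ᴴ * (1 - (2 * s) • A) = 1 := by
    have h1 : A * M * (Mᴴ * A) = A - s • (A * A) := by
      rw [Matrix.mul_assoc, ← Matrix.mul_assoc M, hN, sub_mul, hXA, mul_sub, mul_one]
      simp
    rw [hPH, hCH, Matrix.smul_mul, Matrix.mul_smul, smul_smul, h1]
    simp only [sub_mul, mul_sub, one_mul, mul_one, smul_mul_smul_comm]
    rw [show (2 * c : ℂ) * (2 * c) = 4 * s by rw [← hcs]; ring]
    module
  refine ⟨(2 * c : ℂ) • (A * M), 1 - (2 * s) • A, hsum, ?_⟩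
  -- The positive operator whose trace is the difference of the two sides, up to the factor `c²`.
  have hpos := (hXpos.inv.posSemidef.conjTranspose_mul_mul_same
    ((X - (2 * s) • 1) * M)).trace_nonneg
  have hT : (((X - (2 * s) • 1) * M)ᴴ * X⁻¹ * ((X - (2 * s) • 1) * M)).trace =
      (X * X).trace - 5 * s * X.trace + 8 * s ^ 2 * (1 : Matrix O O ℂ).trace -
        4 * s ^ 3 * A.trace := by
    have h1 : (X - (2 * s) • (1 : Matrix O O ℂ))ᴴ = X - (2 * s) • 1 := by
      rw [Matrix.conjTranspose_sub, Matrix.conjTranspose_smul, hXpos.isHermitian]; simp [hs]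
    have h2 : A * ((X - (2 * s) • 1) * (X - s • 1) * (X - (2 * s) • 1)) =
        X * X - (5 * s) • X + (8 * s ^ 2) • (1 : Matrix O O ℂ) - (4 * s ^ 3) • A := by
      simp only [sub_mul, mul_sub, smul_mul_assoc, mul_smul_comm, one_mul, mul_one, ← mul_assoc,
        hAX]
      module
    rw [Matrix.mul_assoc, Matrix.trace_mul_comm, Matrix.conjTranspose_mul, h1, ← hA,
      Matrix.mul_assoc A, ← Matrix.mul_assoc _ Mᴴ, Matrix.mul_assoc _ M, hN, h2]
    simp only [Matrix.trace_sub, Matrix.trace_add, Matrix.trace_smul, smul_eq_mul]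
  rw [hT] at hpos
  have hnorm : frobSq (((2 * c : ℂ) • (A * M))ᴴ * M) + frobSq ((1 - (2 * s) • A) * M) =
      X.trace.re - c ^ 2 * Fintype.card O := by
    have h1 : ((frobSq (((2 * c : ℂ) • (A * M))ᴴ * M) + frobSq ((1 - (2 * s) • A) * M) : ℝ) : ℂ) =
        X.trace - s * Fintype.card O := by
      push_cast
      rw [← trace_conjTranspose_mul_self, ← trace_conjTranspose_mul_self, ← Matrix.trace_add,
        Matrix.conjTranspose_mul, Matrix.conjTranspose_mul, Matrix.conjTranspose_conjTranspose]
      have : Mᴴ * ((2 * c : ℂ) • (A * M)) * (((2 * c : ℂ) • (A * M))ᴴ * M) +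
          Mᴴ * (1 - (2 * s) • A)ᴴ * ((1 - (2 * s) • A) * M) =
          Mᴴ * (((2 * c : ℂ) • (A * M)) * ((2 * c : ℂ) • (A * M))ᴴ +
            (1 - (2 * s) • A)ᴴ * (1 - (2 * s) • A)) * M := by
        simp only [Matrix.mul_add, Matrix.add_mul, Matrix.mul_assoc]
      rw [this, hsum, Matrix.mul_one, Matrix.trace_mul_comm, hN, Matrix.trace_sub,
        Matrix.trace_smul, Matrix.trace_one, smul_eq_mul]
    have h2 := congrArg Complex.re h1
    rw [Complex.ofReal_re] at h2
    rw [h2, hs]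
    simp [-Complex.ofReal_pow]
  have hcross : (((2 * c : ℂ) • (A * M))ᴴ * M).trace.re =
      2 * c * (Fintype.card O - c ^ 2 * A.trace.re) := by
    have h1 : (((2 * c : ℂ) • (A * M))ᴴ * M).trace =
        (2 * c : ℂ) * (Fintype.card O - s * A.trace) := by
      rw [hPH, Matrix.smul_mul, Matrix.trace_smul, Matrix.mul_assoc, Matrix.trace_mul_comm,
        Matrix.mul_assoc, hN, mul_sub, hAX]
      simp
    rw [h1, hs, show (2 * c : ℂ) = ((2 * c : ℝ) : ℂ) by push_cast; rfl, Complex.re_ofReal_mul,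
      Complex.sub_re, Complex.re_ofReal_mul, Complex.natCast_re]
  have hG : frobSq (Mᴴ * M) = (X * X).trace.re - 2 * c ^ 2 * X.trace.re +
      c ^ 2 * c ^ 2 * Fintype.card O := by
    have h1 : (frobSq (Mᴴ * M) : ℂ) = (X * X).trace - 2 * s * X.trace + s * s * Fintype.card O := by
      rw [← trace_conjTranspose_mul_self, Matrix.conjTranspose_mul,
        Matrix.conjTranspose_conjTranspose, Matrix.mul_assoc, Matrix.trace_mul_comm,
        Matrix.mul_assoc, Matrix.mul_assoc, hN, ← Matrix.mul_assoc, hN]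
      have : (X - s • 1) * (X - s • 1) = X * X - (2 * s) • X + (s * s) • (1 : Matrix O O ℂ) := by
        simp only [sub_mul, mul_sub, smul_mul_assoc, mul_smul_comm, one_mul, mul_one]
        module
      rw [this]
      simp
    have h2 := congrArg Complex.re h1
    rw [Complex.ofReal_re] at h2
    rw [h2, hs]
    simp [-Complex.ofReal_pow, ← Complex.ofReal_mul, ← Complex.ofReal_ofNat, mul_assoc]
  have hGtr : (Mᴴ * M).trace.re = X.trace.re - c ^ 2 * Fintype.card O := by
    rw [Matrix.trace_mul_comm, hN, hs]
    simp [-Complex.ofReal_pow]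
  have hre := (Complex.nonneg_iff.mp hpos).1
  have hre' : 0 ≤ (X * X).trace.re - 5 * c ^ 2 * X.trace.re + 8 * (c ^ 2) ^ 2 * Fintype.card O -
      4 * (c ^ 2) ^ 3 * A.trace.re := by
    rw [hs] at hre
    simpa [← Complex.ofReal_pow, ← Complex.ofReal_mul, ← Complex.ofReal_ofNat, mul_assoc] using hre
  rw [frobSq_sub_smul_one, frobSq_sub_smul_one, hcross, hGtr, hG,
    le_div_iff₀ (by positivity)]
  linear_combination hre' + c ^ 2 * hnorm

end Decoder

/-! ### Closeness of channels from closeness of Kraus operators -/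

section TraceDistance

lemma frobSq_kronecker_one_mul_le {O I S k : Type} [Fintype O] [Fintype I] [Fintype S]
    [DecidableEq S] [Fintype k] (X : Matrix O I ℂ) (R : Matrix (I × S) k ℂ) :
    frobSq ((X ⊗ₖ (1 : Matrix S S ℂ)) * R) ≤ frobSq X * frobSq R := by
  have h : ∀ o s j, ‖((X ⊗ₖ (1 : Matrix S S ℂ)) * R) (o, s) j‖ ^ 2 ≤
      (∑ i, ‖X o i‖ ^ 2) * ∑ i, ‖R (i, s) j‖ ^ 2 := by
    intro o s j
    have h1 : ((X ⊗ₖ (1 : Matrix S S ℂ)) * R) (o, s) j = ∑ i, X o i * R (i, s) j := by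
      simp [Matrix.mul_apply, Fintype.sum_prod_type, Matrix.one_apply]
    rw [h1]
    calc ‖∑ i, X o i * R (i, s) j‖ ^ 2 ≤ (∑ i, ‖X o i‖ * ‖R (i, s) j‖) ^ 2 := by
          gcongr
          exact (norm_sum_le _ _).trans_eq (by simp)
      _ ≤ _ := Finset.sum_mul_sq_le_sq_mul_sq _ _ _
  calc frobSq ((X ⊗ₖ (1 : Matrix S S ℂ)) * R) ≤
        ∑ o, ∑ s, ∑ j, (∑ i, ‖X o i‖ ^ 2) * ∑ i, ‖R (i, s) j‖ ^ 2 := by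
        rw [frobSq, Fintype.sum_prod_type]
        gcongr
        exact h _ _ _
    _ = frobSq X * frobSq R := by
        simp only [frobSq, ← Finset.mul_sum, ← Finset.sum_mul, Fintype.sum_prod_type]
        congr 1
        rw [Finset.sum_comm (γ := I)]
        exact Finset.sum_congr rfl fun s _ => Finset.sum_comm

lemma frobSq_mul_le {p q k : Type} [Fintype p] [Fintype q] [DecidableEq q] [Fintype k]
    (F : Matrix p q ℂ) (hF : (1 - Fᴴ * F).PosSemidef) (Y : Matrix q k ℂ) :
    frobSq (F * Y) ≤ frobSq Y := by
  have h := (hF.conjTranspose_mul_mul_same Y).trace_nonneg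
  have h2 : (Yᴴ * (1 - Fᴴ * F) * Y).trace = ((frobSq Y - frobSq (F * Y) : ℝ) : ℂ) := by
    push_cast
    rw [← trace_conjTranspose_mul_self, ← trace_conjTranspose_mul_self,
      Matrix.conjTranspose_mul, Matrix.mul_sub, Matrix.sub_mul, Matrix.trace_sub, Matrix.mul_one]
    simp only [Matrix.mul_assoc]
  rw [h2] at h
  have := Complex.zero_le_real.mp h
  linarith

variable {J O I S : Type} [Fintype J] [Fintype O] [Fintype I] [DecidableEq I]
  [Fintype S] [DecidableEq S]

lemma sum_frobSq_kronecker_one_mul {k : Type} [Fintype k] (A : J → Matrix O I ℂ)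
    (hA : ∑ j, (A j)ᴴ * A j = 1) (R : Matrix (I × S) k ℂ) :
    ∑ j, frobSq ((A j ⊗ₖ (1 : Matrix S S ℂ)) * R) = frobSq R := by
  apply Complex.ofReal_injective
  push_cast
  simp only [← trace_conjTranspose_mul_self]
  rw [← Matrix.trace_sum]
  congr 1
  have h : ∀ j, ((A j ⊗ₖ (1 : Matrix S S ℂ)) * R)ᴴ * ((A j ⊗ₖ (1 : Matrix S S ℂ)) * R) =
      Rᴴ * (((A j)ᴴ * A j) ⊗ₖ (1 : Matrix S S ℂ)) * R := by
    intro j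
    rw [Matrix.conjTranspose_mul, Matrix.conjTranspose_kronecker, Matrix.conjTranspose_one,
      Matrix.mul_assoc, ← Matrix.mul_assoc _ _ R, ← Matrix.mul_kronecker_mul, Matrix.mul_one,
      Matrix.mul_assoc]
  have h2 : ∑ j, ((A j)ᴴ * A j) ⊗ₖ (1 : Matrix S S ℂ) = 1 := by
    rw [← Matrix.one_kronecker_one, ← hA]
    ext x y
    simp [Matrix.sum_apply, Finset.sum_mul]
  simp only [h]
  rw [← Matrix.sum_mul, ← Matrix.mul_sum, h2, Matrix.mul_one]

variable [DecidableEq O]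

/-- Channels whose Kraus operators are close in the Hilbert–Schmidt norm are close in trace
distance, also in the presence of a reference system. -/
lemma abs_trace_sub_le (A B : J → Matrix O I ℂ) (hA : ∑ j, (A j)ᴴ * A j = 1)
    (hB : ∑ j, (B j)ᴴ * B j = 1) {η : ℝ} (hη : 0 ≤ η) (h : ∑ j, frobSq (A j - B j) ≤ η ^ 2)
    {ρ : Matrix (I × S) (I × S) ℂ} (hρ : IsDensity ρ) {E : Matrix (O × S) (O × S) ℂ}
    (hE : E.PosSemidef) (hE' : (1 - E).PosSemidef) :
    |(E * ∑ j, (A j ⊗ₖ (1 : Matrix S S ℂ)) * ρ * (A j ⊗ₖ (1 : Matrix S S ℂ))ᴴ).trace.re -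
      (E * ∑ j, (B j ⊗ₖ (1 : Matrix S S ℂ)) * ρ * (B j ⊗ₖ (1 : Matrix S S ℂ))ᴴ).trace.re| ≤
      2 * η := by
  obtain ⟨F, rfl⟩ := exists_eq_conjTranspose_mul_self hE
  obtain ⟨R', hR'⟩ := exists_eq_conjTranspose_mul_self hρ.1
  obtain ⟨R, hR⟩ : ∃ R : Matrix (I × S) (I × S) ℂ, ρ = R * Rᴴ := ⟨R'ᴴ, by simpa using hR'⟩
  have hR1 : frobSq R = 1 := by
    apply Complex.ofReal_injective
    rw [← trace_conjTranspose_mul_self, Matrix.trace_mul_comm, ← hR, hρ.2, Complex.ofReal_one]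
  let vec : (J → Matrix O I ℂ) → EuclideanSpace ℂ (J × (O × S) × (I × S)) := fun A =>
    WithLp.toLp 2 fun x => (F * ((A x.1 ⊗ₖ (1 : Matrix S S ℂ)) * R)) x.2.1 x.2.2
  have hvec : ∀ A, ‖vec A‖ ^ 2 = ∑ j, frobSq (F * ((A j ⊗ₖ (1 : Matrix S S ℂ)) * R)) := by
    intro A
    rw [EuclideanSpace.norm_sq_eq, Fintype.sum_prod_type]
    simp only [Fintype.sum_prod_type (α₁ := O × S) (α₂ := I × S), frobSq, vec]
  have htr : ∀ A : J → Matrix O I ℂ,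
      (Fᴴ * F * ∑ j, (A j ⊗ₖ (1 : Matrix S S ℂ)) * ρ * (A j ⊗ₖ (1 : Matrix S S ℂ))ᴴ).trace.re =
        ‖vec A‖ ^ 2 := by
    intro A
    have h1 : (Fᴴ * F * ∑ j, (A j ⊗ₖ (1 : Matrix S S ℂ)) * ρ *
        (A j ⊗ₖ (1 : Matrix S S ℂ))ᴴ).trace =
        ((∑ j, frobSq (F * ((A j ⊗ₖ (1 : Matrix S S ℂ)) * R)) : ℝ) : ℂ) := by
      rw [Matrix.mul_sum, Matrix.trace_sum, Complex.ofReal_sum]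
      refine Finset.sum_congr rfl fun j _ => ?_
      rw [← trace_conjTranspose_mul_self, Matrix.trace_mul_comm (_ᴴ), hR, Matrix.mul_assoc Fᴴ,
        Matrix.trace_mul_comm Fᴴ]
      simp only [Matrix.conjTranspose_mul, Matrix.mul_assoc]
    rw [hvec, h1, Complex.ofReal_re]
  have hle : ∀ A : J → Matrix O I ℂ, ∑ j, (A j)ᴴ * A j = 1 → ‖vec A‖ ≤ 1 := by
    intro A hA
    have : ‖vec A‖ ^ 2 ≤ 1 := by
      rw [hvec, ← hR1, ← sum_frobSq_kronecker_one_mul A hA R]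
      exact Finset.sum_le_sum fun j _ => frobSq_mul_le F hE' _
    nlinarith [norm_nonneg (vec A)]
  have hsub : ‖vec A - vec B‖ ≤ η := by
    have h1 : vec A - vec B = vec (fun j => A j - B j) := by
      have h2 : ∀ j, (A j - B j) ⊗ₖ (1 : Matrix S S ℂ) = A j ⊗ₖ 1 - B j ⊗ₖ 1 := fun j => by
        ext; simp [sub_mul]
      ext x
      simp [vec, h2, Matrix.sub_mul, Matrix.mul_sub]
    rw [h1]
    refine (pow_le_pow_iff_left₀ (norm_nonneg _) hη two_ne_zero).mp ?_
    refine (hvec fun j => A j - B j).trans_le ?_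
    refine le_trans (Finset.sum_le_sum fun j _ => (frobSq_mul_le F hE' _).trans
      (frobSq_kronecker_one_mul_le _ _)) ?_
    rwa [← Finset.sum_mul, hR1, mul_one]
  rw [htr, htr, sq_sub_sq, abs_mul, abs_of_nonneg (by positivity)]
  have h1 := hle A hA
  have h2 := hle B hB
  have h3 := (abs_norm_sub_norm_le (vec A) (vec B)).trans hsub
  have h4 := abs_nonneg (‖vec A‖ - ‖vec B‖)
  nlinarith [norm_nonneg (vec A), norm_nonneg (vec B)]

end TraceDistance

/-! ### Approximate error correction -/

section Recovery

variable {J O I : Type} [Fintype J] [Fintype I]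

/-- The completely positive map with Kraus operators `K`. -/
def krausMap (K : J → Matrix O I ℂ) : Matrix I I ℂ →ₗ[ℂ] Matrix O O ℂ where
  toFun X := ∑ j, K j * X * (K j)ᴴ
  map_add' X Y := by simp [Matrix.mul_add, Matrix.add_mul, Finset.sum_add_distrib]
  map_smul' c X := by simp [Finset.smul_sum]

lemma krausMap_apply (K : J → Matrix O I ℂ) (X : Matrix I I ℂ) :
    krausMap K X = ∑ j, K j * X * (K j)ᴴ := rfl

lemma extend_krausMap (K : J → Matrix O I ℂ) (S : Type) [Fintype S] [DecidableEq S]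
    (ρ : Matrix (I × S) (I × S) ℂ) :
    extend (krausMap K) S ρ =
      ∑ j, (K j ⊗ₖ (1 : Matrix S S ℂ)) * ρ * (K j ⊗ₖ (1 : Matrix S S ℂ))ᴴ := by
  ext ⟨o, s⟩ ⟨o', s'⟩
  simp only [extend, Matrix.of_apply, krausMap_apply, Matrix.sum_apply]
  refine Finset.sum_congr rfl fun j _ => ?_
  simp [Matrix.mul_apply, Fintype.sum_prod_type, Matrix.one_apply, Finset.sum_mul,
    apply_ite (starRingEnd ℂ)]

variable [Fintype O]

lemma isChannel_krausMap [DecidableEq I] (K : J → Matrix O I ℂ) (hK : ∑ j, (K j)ᴴ * K j = 1) :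
    IsChannel (krausMap K) := by
  let e := Fintype.equivFin J
  refine ⟨Fintype.card J, fun j => K (e.symm j), ?_, fun X => ?_⟩
  · rw [← hK]
    exact e.symm.sum_comp fun j => (K j)ᴴ * K j
  · rw [krausMap_apply]
    exact (e.symm.sum_comp fun j => K j * X * (K j)ᴴ).symm

lemma krausMap_comp_krausMap {J' P : Type} [Fintype J'] [Fintype P] (K : J' → Matrix P O ℂ)
    (M : J → Matrix O I ℂ) :
    krausMap K ∘ₗ krausMap M = krausMap fun x : J' × J => K x.1 * M x.2 := by
  ext1 X
  simp only [LinearMap.comp_apply, krausMap_apply, Fintype.sum_prod_type, Matrix.mul_sum,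
    Matrix.sum_mul, Matrix.conjTranspose_mul, Matrix.mul_assoc]

variable [DecidableEq I]

/-- A channel whose Kraus operators are close to scalars is close to the identity channel. -/
lemma traceDistLE_extend_of_scalar (A : J → Matrix I I ℂ) (z : J → ℂ)
    (hA : ∑ j, (A j)ᴴ * A j = 1) (hz : ∑ j, star (z j) * z j = 1) {η : ℝ} (hη : 0 ≤ η)
    (h : ∑ j, frobSq (A j - z j • 1) ≤ η ^ 2) (S : Type) [Fintype S] [DecidableEq S]
    (ρ : Matrix (I × S) (I × S) ℂ) (hρ : IsDensity ρ) :
    TraceDistLE (extend (krausMap A) S ρ) ρ (2 * η) := by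
  intro E hE hE'
  have hB : ∑ j, (z j • (1 : Matrix I I ℂ))ᴴ * (z j • (1 : Matrix I I ℂ)) = 1 := by
    simp only [Matrix.conjTranspose_smul, Matrix.conjTranspose_one, smul_mul_smul_comm, mul_one]
    rw [← Finset.sum_smul, hz, one_smul]
  have hid : ∑ j, ((z j • (1 : Matrix I I ℂ)) ⊗ₖ (1 : Matrix S S ℂ)) * ρ *
      ((z j • (1 : Matrix I I ℂ)) ⊗ₖ (1 : Matrix S S ℂ))ᴴ = ρ := by
    simp only [Matrix.smul_kronecker, Matrix.one_kronecker_one, Matrix.conjTranspose_smul,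
      Matrix.conjTranspose_one, smul_mul_assoc, mul_smul_comm, one_mul, mul_one, smul_smul]
    rw [← Finset.sum_smul, hz, one_smul]
  have := abs_trace_sub_le A (fun j => z j • 1) hA hB hη h hρ hE hE'
  rwa [hid, ← extend_krausMap] at this

variable {b : Type} [Fintype b] [DecidableEq b] [DecidableEq O]

/-- The operator `∑ k, M k ⊗ ⟨k|`, with the Kraus operators `M k` as its blocks. -/
def blockRow (M : b → Matrix O I ℂ) : Matrix O (b × I) ℂ :=
  Matrix.of fun x y => M y.1 x y.2

/-- Approximate quantum error correction: if the Kraus operators of a channel nearly satisfy the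
Knill–Laflamme condition `(M k)ᴴ M l = δ_{kl} / |b|`, then the channel can be undone. -/
theorem exists_recovery [Nonempty b] [Nonempty I] (M : b → Matrix O I ℂ)
    (hM : ∑ k, (M k)ᴴ * M k = 1) {η : ℝ} (hη : 0 ≤ η)
    (h : Fintype.card b * frobSq ((blockRow M)ᴴ * blockRow M -
      (((Fintype.card b : ℝ)⁻¹ : ℝ) : ℂ) • 1) ≤ η ^ 2) :
    ∃ D : Matrix O O ℂ →ₗ[ℂ] Matrix I I ℂ, IsChannel D ∧
      ∀ (S : Type) [Fintype S] [DecidableEq S] (ρ : Matrix (I × S) (I × S) ℂ), IsDensity ρ →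
        TraceDistLE (extend (D ∘ₗ krausMap M) S ρ) ρ (2 * η) := by
  obtain ⟨i₀⟩ := ‹Nonempty I›
  have hb : (0 : ℝ) < Fintype.card b := by exact_mod_cast Fintype.card_pos
  set c : ℝ := Real.sqrt (Fintype.card b : ℝ)⁻¹
  have hc : 0 < c := Real.sqrt_pos.mpr (inv_pos.mpr hb)
  have hc2 : c ^ 2 = (Fintype.card b : ℝ)⁻¹ := Real.sq_sqrt (inv_pos.mpr hb).le
  obtain ⟨P, C, hPC, hle⟩ := exists_approximate_inverse (blockRow M) hc
  -- Apply `Pᴴ` and discard `b`; the defect of `P` is sent to a fixed basis state.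
  let K : b ⊕ O → Matrix I O ℂ := Sum.elim (fun k => Matrix.of fun q x => star (P x (k, q)))
    (fun i => Matrix.of fun q x => if q = i₀ then C i x else 0)
  have hK : ∑ j, (K j)ᴴ * K j = 1 := by
    rw [← hPC, Fintype.sum_sum_type]
    congr 1
    · ext x y
      simp [K, Matrix.sum_apply, Matrix.mul_apply, Fintype.sum_prod_type]
    · ext x y
      simp [K, Matrix.sum_apply, Matrix.mul_apply]
  refine ⟨krausMap K, isChannel_krausMap K hK, ?_⟩
  rw [krausMap_comp_krausMap]
  let z : (b ⊕ O) × b → ℂ := fun x => Sum.elim (fun k => if k = x.2 then (c : ℂ) else 0)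
    (fun _ => 0) x.1
  refine traceDistLE_extend_of_scalar _ z ?_ ?_ hη ?_
  · simp only [Fintype.sum_prod_type, Matrix.conjTranspose_mul]
    rw [Finset.sum_comm, ← hM]
    refine Finset.sum_congr rfl fun k _ => ?_
    calc ∑ j, (M k)ᴴ * (K j)ᴴ * (K j * M k) = (M k)ᴴ * (∑ j, (K j)ᴴ * K j) * M k := by
          simp only [Matrix.mul_sum, Matrix.sum_mul, Matrix.mul_assoc]
      _ = _ := by rw [hK, Matrix.mul_one]
  · simp only [z, Fintype.sum_prod_type, Fintype.sum_sum_type, Sum.elim_inl, Sum.elim_inr]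
    simp
    rw [← Complex.ofReal_mul, ← pow_two, hc2]
    push_cast
    exact mul_inv_cancel₀ (by exact_mod_cast hb.ne')
  · rw [hc2, div_inv_eq_mul, mul_comm] at hle
    refine le_trans (le_of_eq ?_) (hle.trans h)
    rw [Fintype.sum_prod_type, Fintype.sum_sum_type]
    congr 1
    · have hent : ∀ k k' q q',
          (K (Sum.inl k) * M k' - z (Sum.inl k, k') • (1 : Matrix I I ℂ)) q q' =
          (Pᴴ * blockRow M - (c : ℂ) • (1 : Matrix (b × I) (b × I) ℂ)) (k, q) (k', q') := by
        intro k k' q q'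
        simp only [K, z, Matrix.sub_apply, Matrix.mul_apply, Matrix.smul_apply, Matrix.one_apply,
          Sum.elim_inl, Matrix.of_apply, Matrix.conjTranspose_apply, blockRow, Prod.mk.injEq,
          smul_eq_mul]
        congr 1
        split_ifs <;> simp_all
      simp only [frobSq, hent, Fintype.sum_prod_type]
      exact Finset.sum_congr rfl fun k _ => Finset.sum_comm
    · have hent : ∀ i k' q q',
          (K (Sum.inr i) * M k' - z (Sum.inr i, k') • (1 : Matrix I I ℂ)) q q' =
          if q = i₀ then (C * blockRow M) i (k', q') else 0 := by
        intro i k' q q'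
        simp only [K, z, Matrix.sub_apply, Matrix.mul_apply, Sum.elim_inr,
          Matrix.of_apply, blockRow, zero_smul]
        split_ifs <;> simp
      simp only [frobSq, hent, Fintype.sum_prod_type]
      refine Finset.sum_congr rfl fun i _ => Finset.sum_congr rfl fun k _ => ?_
      rw [Finset.sum_comm]
      refine Finset.sum_congr rfl fun q' _ => ?_
      rw [Finset.sum_eq_single i₀ (by intro q _ hq; simp [hq]) (by simp)]
      simp

end Recovery

/-! ### Reconstruction from the Hawking radiation -/

namespace Experiment

variable {L B R B' R' : Type} [Fintype L] [DecidableEq L] [Fintype B] [DecidableEq B]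
  [Fintype R]

/-- The isometry `|q⟩ |β⟩ ↦ |q⟩ |record q⟩ |β⟩`, which describes Alice's measurement when the black
hole is in the state `|β⟩`. -/
def recordIsometry (X : Experiment L B R B' R') : Matrix ((Fin 2 × L) × B) (Fin 2 × B) ℂ :=
  Matrix.of fun x v => compKet v.1 x.1.1 * X.record v.1 x.1.2 * if x.2 = v.2 then 1 else 0

lemma recordIsometry_isometry (X : Experiment L B R B' R') :
    X.recordIsometryᴴ * X.recordIsometry = 1 := by
  ext ⟨q, β⟩ ⟨q', β'⟩
  have h := X.record_orthonormal q q'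
  simp only [dotProduct, Pi.star_apply] at h
  simp only [Matrix.mul_apply, recordIsometry, Matrix.conjTranspose_apply, Matrix.of_apply,
    Fintype.sum_prod_type, compKet, Pi.single_apply, Matrix.one_apply, Prod.mk.injEq]
  by_cases hq : q = q'
  · subst hq
    by_cases hβ : β = β'
    · subst hβ
      simpa [apply_ite, ite_and] using h
    · simp [hβ, Ne.symm hβ, apply_ite]
  · simp [hq, apply_ite, Ne.symm hq]

variable [DecidableEq R]

lemma evolve_apply (X : Experiment L B R B' R') (U : Matrix.unitaryGroup ((Fin 2 × L) × B) ℂ)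
    (x : (Fin 2 × L) × B) (k : R) (q : Fin 2) :
    X.evolve U (x, k) q = ((Real.sqrt (Fintype.card B) : ℝ) : ℂ)⁻¹ *
      ∑ β, ((U : Matrix ((Fin 2 × L) × B) ((Fin 2 × L) × B) ℂ) * X.recordIsometry) x (q, β) *
        X.partner β k := by
  have hprep : ∀ y : (Fin 2 × L) × B, ((((X.meas : Matrix (Fin 2 × L) (Fin 2 × L) ℂ) ⊗ₖ
      (1 : Matrix B B ℂ)) ⊗ₖ (1 : Matrix R R ℂ)) * X.prepare) (y, k) q =
      compKet q y.1.1 * X.record q y.1.2 *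
        (((Real.sqrt (Fintype.card B) : ℝ) : ℂ)⁻¹ * X.partner y.2 k) := by
    rintro ⟨y, β⟩
    have h := congrFun (X.meas_spec q) y
    simp only [Matrix.mulVec, dotProduct] at h
    rw [← h]
    simp [Matrix.mul_apply, Fintype.sum_prod_type, prepare, Matrix.one_apply, mul_assoc]
    rw [add_mul, Finset.sum_mul, Finset.sum_mul]
    simp only [mul_assoc]
  have hsplit : X.evolve U = ((U : Matrix ((Fin 2 × L) × B) ((Fin 2 × L) × B) ℂ) ⊗ₖ
      (1 : Matrix R R ℂ)) * ((((X.meas : Matrix (Fin 2 × L) (Fin 2 × L) ℂ) ⊗ₖ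
      (1 : Matrix B B ℂ)) ⊗ₖ (1 : Matrix R R ℂ)) * X.prepare) := by
    rw [evolve, ← Matrix.mul_assoc, ← Matrix.mul_kronecker_mul, Matrix.one_mul]
  have h1 : X.evolve U (x, k) q = ∑ y : (Fin 2 × L) × B,
      (U : Matrix ((Fin 2 × L) × B) ((Fin 2 × L) × B) ℂ) x y * (compKet q y.1.1 *
        X.record q y.1.2 * (((Real.sqrt (Fintype.card B) : ℝ) : ℂ)⁻¹ * X.partner y.2 k)) := by
    rw [hsplit, Matrix.mul_apply, Fintype.sum_prod_type]
    refine Finset.sum_congr rfl fun y _ => ?_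
    rw [← hprep]
    simp [Matrix.one_apply]
  rw [h1]
  simp only [Matrix.mul_apply, recordIsometry, Matrix.of_apply, Finset.sum_mul, Finset.mul_sum]
  rw [Finset.sum_comm]
  refine Finset.sum_congr rfl fun y _ => ?_
  rw [Finset.sum_eq_single y.2 (by intro β _ h; simp [h.symm]) (by simp)]
  simp only [if_true]
  ring

/-- The Kraus operators of the channel from `Q` to the radiation, labelled by the states of the
remaining black hole. -/
noncomputable def radiationKraus (X : Experiment L B R B' R')
    (U : Matrix.unitaryGroup ((Fin 2 × L) × B) ℂ) (k : B') : Matrix (R' × R) (Fin 2) ℂ :=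
  Matrix.of fun x q => X.evolve U (X.split.symm (k, x.1), x.2) q

lemma toRadiation_eq_krausMap [Fintype B'] (X : Experiment L B R B' R')
    (U : Matrix.unitaryGroup ((Fin 2 × L) × B) ℂ) :
    X.toRadiation U = krausMap (X.radiationKraus U) := by
  ext1 ρ
  ext x y
  simp [toRadiation, krausMap_apply, Matrix.sum_apply, radiationKraus, Matrix.mul_apply]

lemma blockRow_gram [Fintype R'] (X : Experiment L B R B' R')
    (U : Matrix.unitaryGroup ((Fin 2 × L) × B) ℂ) :
    (blockRow (X.radiationKraus U))ᴴ * blockRow (X.radiationKraus U) =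
      gram X.split ((U : Matrix ((Fin 2 × L) × B) ((Fin 2 × L) × B) ℂ) * X.recordIsometry) := by
  ext ⟨k, q⟩ ⟨k', q'⟩
  have hsqrt : (((Real.sqrt (Fintype.card B) : ℝ) : ℂ)⁻¹) * ((Real.sqrt (Fintype.card B) : ℝ) : ℂ)⁻¹
      = (Fintype.card B : ℂ)⁻¹ := by
    rw [← mul_inv, ← Complex.ofReal_mul, Real.mul_self_sqrt (Nat.cast_nonneg _)]
    simp
  have hstar : star (((Real.sqrt (Fintype.card B) : ℝ) : ℂ)⁻¹) =
      ((Real.sqrt (Fintype.card B) : ℝ) : ℂ)⁻¹ := by simp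
  simp only [Matrix.mul_apply (M := _ᴴ), Matrix.conjTranspose_apply, blockRow, radiationKraus,
    Matrix.of_apply, gram, Fintype.sum_prod_type, evolve_apply]
  set Z := (U : Matrix ((Fin 2 × L) × B) ((Fin 2 × L) × B) ℂ) * X.recordIsometry
  rw [Finset.mul_sum]
  refine Finset.sum_congr rfl fun r _ => ?_
  have horth : ∀ i j, ∑ x, star (X.partner i x) * X.partner j x = if i = j then 1 else 0 :=
    X.partner_orthonormal
  calc _ = ∑ x, ∑ β, ∑ β', (Fintype.card B : ℂ)⁻¹ *
        (star (Z (X.split.symm (k, r)) (q, β)) * Z (X.split.symm (k', r)) (q', β')) *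
          (star (X.partner β x) * X.partner β' x) := by
        refine Finset.sum_congr rfl fun x _ => ?_
        rw [star_mul', star_sum, hstar, mul_mul_mul_comm, hsqrt, Finset.sum_mul_sum, Finset.mul_sum]
        refine Finset.sum_congr rfl fun β _ => ?_
        rw [Finset.mul_sum]
        refine Finset.sum_congr rfl fun β' _ => ?_
        simp only [star_mul']
        ring
    _ = ∑ β, ∑ β', (Fintype.card B : ℂ)⁻¹ *
        (star (Z (X.split.symm (k, r)) (q, β)) * Z (X.split.symm (k', r)) (q', β')) *
          ∑ x, (star (X.partner β x) * X.partner β' x) := by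
        rw [Finset.sum_comm]
        refine Finset.sum_congr rfl fun β _ => ?_
        rw [Finset.sum_comm]
        simp only [Finset.mul_sum]
    _ = _ := by
        simp only [horth, mul_ite, mul_one, mul_zero, Finset.sum_ite_eq, Finset.mem_univ, if_true,
          Finset.mul_sum]

variable [Fintype B'] [Fintype R']

lemma sum_radiationKraus [Nonempty B] [DecidableEq R'] (X : Experiment L B R B' R')
    (U : Matrix.unitaryGroup ((Fin 2 × L) × B) ℂ) :
    ∑ k, (X.radiationKraus U k)ᴴ * X.radiationKraus U k = 1 := by
  set Z := (U : Matrix ((Fin 2 × L) × B) ((Fin 2 × L) × B) ℂ) * X.recordIsometry with hZdef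
  have hZ : Zᴴ * Z = 1 := by
    have := Matrix.mem_unitaryGroup_iff'.mp U.2
    rw [Matrix.star_eq_conjTranspose] at this
    rw [hZdef, Matrix.conjTranspose_mul, Matrix.mul_assoc, ← Matrix.mul_assoc _ _ X.recordIsometry,
      this, Matrix.one_mul, recordIsometry_isometry]
  ext q q'
  have h1 : ∀ k, ((X.radiationKraus U k)ᴴ * X.radiationKraus U k) q q' =
      gram X.split Z (k, q) (k, q') := fun k => by
    rw [hZdef, ← blockRow_gram]
    rfl
  have h2 : ∀ β, ∑ x, star (Z x (q, β)) * Z x (q', β) = if q = q' then 1 else 0 := by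
    intro β
    have := congrFun (congrFun hZ (q, β)) (q', β)
    simpa [Matrix.mul_apply, Matrix.one_apply] using this
  have hB : (Fintype.card B : ℂ) ≠ 0 := by simp
  calc _ = ∑ k, gram X.split Z (k, q) (k, q') := by simp only [Matrix.sum_apply, h1]
    _ = (Fintype.card B : ℂ)⁻¹ * ∑ β, ∑ x, star (Z x (q, β)) * Z x (q', β) := by
        rw [Finset.sum_comm, ← X.split.symm.sum_comp, Fintype.sum_prod_type, Finset.mul_sum]
        simp only [gram, Matrix.of_apply, Finset.mul_sum]
    _ = _ := by
        simp only [h2, Finset.sum_const, Finset.card_univ, nsmul_eq_mul, Matrix.one_apply]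
        rw [inv_mul_cancel_left₀ hB]

lemma exists_executable [Nonempty B] [Nonempty B'] [DecidableEq B'] [DecidableEq R']
    (X : Experiment L B R B' R')
    (U : Matrix.unitaryGroup ((Fin 2 × L) × B) ℂ) {ε : ℝ} (hε : 0 < ε)
    (h : frobSq (gram X.split
      ((U : Matrix ((Fin 2 × L) × B) ((Fin 2 × L) × B) ℂ) * X.recordIsometry) -
        (((Fintype.card B' : ℝ)⁻¹ : ℝ) : ℂ) • 1) ≤ (ε / 2) ^ 2 / Fintype.card B') :
    ∃ D, X.Executable U D ε := by
  have hb : (0 : ℝ) < Fintype.card B' := by exact_mod_cast Fintype.card_pos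
  rw [le_div_iff₀ hb, ← blockRow_gram, mul_comm] at h
  obtain ⟨D, hD, hD'⟩ := exists_recovery (X.radiationKraus U) (X.sum_radiationKraus U)
    (by positivity : 0 ≤ ε / 2) h
  refine ⟨D, hD, fun S _ _ ρ hρ => ?_⟩
  have := hD' S ρ hρ
  rwa [mul_div_cancel₀ _ two_ne_zero, ← toRadiation_eq_krausMap] at this

/-- The Hayden–Preskill theorem: by Markov's inequality, the decoupling estimate makes decoding
possible for most `U`. -/
theorem haarUnitary_not_executable_le [Nonempty B] [DecidableEq R'] (X : Experiment L B R B' R')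
    {ε δ : ℝ} (hε : 0 < ε) (hδ : 0 < δ)
    (h : 32 / (ε ^ 2 * δ) * (Fintype.card L : ℝ) ≤ (Fintype.card R' : ℝ) ^ 2) :
    haarUnitary ((Fin 2 × L) × B) {U | ¬ ∃ D, X.Executable U D ε} ≤ ENNReal.ofReal δ := by
  classical
  have hL : Nonempty L := by
    by_contra hL
    rw [not_nonempty_iff] at hL
    simpa using X.lab_unit
  obtain ⟨l⟩ := hL
  obtain ⟨β⟩ := ‹Nonempty B›
  have : Nonempty B := ⟨β⟩
  have : Nonempty B' := ⟨(X.split ((0, l), β)).1⟩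
  have : Nonempty R' := ⟨(X.split ((0, l), β)).2⟩
  have : Nontrivial ((Fin 2 × L) × B) := ⟨((0, l), β), ((1, l), β), by simp⟩
  obtain ⟨hint, hle⟩ := integral_frobSq_gram_le X.split X.recordIsometry X.recordIsometry_isometry
  set f : Matrix.unitaryGroup ((Fin 2 × L) × B) ℂ → ℝ := fun U => frobSq (gram X.split
      ((U : Matrix ((Fin 2 × L) × B) ((Fin 2 × L) × B) ℂ) * X.recordIsometry) -
        (((Fintype.card B' : ℝ)⁻¹ : ℝ) : ℂ) • 1) with hf
  have hmarkov := mul_meas_ge_le_integral_of_nonneg (f := f)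
    (μ := haarUnitary ((Fin 2 × L) × B)) (Filter.Eventually.of_forall fun U => frobSq_nonneg _) hint
    ((ε / 2) ^ 2 / Fintype.card B')
  have hB : (0 : ℝ) < Fintype.card B := by exact_mod_cast Fintype.card_pos
  have hB' : (0 : ℝ) < Fintype.card B' := by exact_mod_cast Fintype.card_pos
  have hR' : (0 : ℝ) < Fintype.card R' := by exact_mod_cast Fintype.card_pos
  have hcard : 2 * (Fintype.card L : ℝ) * Fintype.card B = Fintype.card B' * Fintype.card R' := by
    have := Fintype.card_congr X.split
    simp only [Fintype.card_prod, Fintype.card_fin] at this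
    exact_mod_cast this
  have hreal : (haarUnitary ((Fin 2 × L) × B)).real
      {U | (ε / 2) ^ 2 / Fintype.card B' ≤ f U} ≤ δ := by
    have h1 := hmarkov.trans hle
    rw [Fintype.card_fin, Nat.cast_ofNat, div_mul_eq_mul_div, div_le_iff₀ hB', div_mul_eq_mul_div,
      le_div_iff₀ (by positivity)] at h1
    rw [div_mul_eq_mul_div, div_le_iff₀ (by positivity)] at h
    have h2 : (haarUnitary ((Fin 2 × L) × B)).real {U | (ε / 2) ^ 2 / Fintype.card B' ≤ f U} *
        (ε ^ 2 * Fintype.card R' ^ 2 * Fintype.card B) ≤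
        δ * (ε ^ 2 * Fintype.card R' ^ 2 * Fintype.card B) := by
      have h3 := mul_le_mul_of_nonneg_right h1 hR'.le
      have h4 := mul_le_mul_of_nonneg_right h hB.le
      linear_combination 4 * h3 + h4 - 16 * hcard
    exact le_of_mul_le_mul_right h2 (by positivity)
  calc haarUnitary ((Fin 2 × L) × B) {U | ¬ ∃ D, X.Executable U D ε} ≤
      haarUnitary ((Fin 2 × L) × B) {U | (ε / 2) ^ 2 / Fintype.card B' ≤ f U} := by
        refine measure_mono fun U hU => ?_
        by_contra hlt
        exact hU (X.exists_executable U hε (not_le.mp hlt).le)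
    _ ≤ ENNReal.ofReal δ := by
        rw [← ofReal_measureReal]
        exact ENNReal.ofReal_le_ofReal hreal

end Experiment

/-! ### The contradiction with objective outcomes -/

section Paradox

lemma apply_eq_zero_of_diag_eq_zero {m : Type} [Fintype m] [DecidableEq m] {A : Matrix m m ℂ}
    (hA : A.PosSemidef) {i : m} (h : A i i = 0) (j : m) : A i j = 0 ∧ A j i = 0 := by
  obtain ⟨F, rfl⟩ := exists_eq_conjTranspose_mul_self hA
  have hF : ∀ k, F k i = 0 := by
    have h1 : ((∑ k, ‖F k i‖ ^ 2 : ℝ) : ℂ) = 0 := by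
      rw [← h, Matrix.mul_apply]
      push_cast
      exact Finset.sum_congr rfl fun k _ => by
        rw [Matrix.conjTranspose_apply, ← Complex.conj_mul']; rfl
    intro k
    have h2 := (Finset.sum_eq_zero_iff_of_nonneg fun k _ => sq_nonneg ‖F k i‖).mp
      (Complex.ofReal_eq_zero.mp h1) k (Finset.mem_univ k)
    simpa using h2
  constructor <;> simp [Matrix.mul_apply, hF]

lemma sum_diagKet_mul (b b' : Fin 2) :
    ∑ q, diagKet b q * diagKet b' q = if b = b' then 1 else 0 := by
  have h : (((Real.sqrt 2 : ℝ) : ℂ))⁻¹ * ((Real.sqrt 2 : ℝ) : ℂ)⁻¹ = 1 / 2 := by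
    rw [← mul_inv, ← Complex.ofReal_mul, Real.mul_self_sqrt (by norm_num)]
    norm_num
  fin_cases b <;> fin_cases b' <;> (simp [diagKet, h]; try norm_num)

lemma star_diagKet (b q : Fin 2) : star (diagKet b q) = diagKet b q := by
  simp [diagKet]

lemma diagKet_mul_self (b q : Fin 2) : diagKet b q * diagKet b q = 1 / 2 := by
  have h : (((Real.sqrt 2 : ℝ) : ℂ))⁻¹ * ((Real.sqrt 2 : ℝ) : ℂ)⁻¹ = 1 / 2 := by
    rw [← mul_inv, ← Complex.ofReal_mul, Real.mul_self_sqrt (by norm_num)]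
    norm_num
  fin_cases b <;> fin_cases q <;> simp [diagKet, h]

lemma measuredState_apply {S : Type} [Fintype S] [DecidableEq S] (v : Fin 2 → ℂ)
    (ρ : Matrix (Fin 2 × S) (Fin 2 × S) ℂ) (s s' : S) :
    measuredState v ρ s s' = ∑ i, ∑ q, v i * star (v q) * ρ (q, s) (i, s') := by
  simp [measuredState, partialTraceFst, Matrix.mul_apply, Fintype.sum_prod_type, Matrix.one_apply,
    Matrix.vecMulVec_apply]

variable {S : Type} [DecidableEq S]

/-- The maximally entangled state of a qubit and the two basis vectors of `S` selected by `t`. -/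
noncomputable def bellState (t : Fin 2 → S) : Matrix (Fin 2 × S) (Fin 2 × S) ℂ :=
  (1 / 2 : ℂ) • Matrix.vecMulVec (fun x => if x.2 = t x.1 then 1 else 0)
    (star fun x => if x.2 = t x.1 then 1 else 0)

lemma bellState_apply (t : Fin 2 → S) (x y : Fin 2 × S) :
    bellState t x y = 1 / 2 * ((if x.2 = t x.1 then 1 else 0) * if y.2 = t y.1 then 1 else 0) := by
  simp [bellState, Matrix.vecMulVec_apply]

variable [Fintype S]

lemma isDensity_bellState (t : Fin 2 → S) : IsDensity (bellState t) := by
  refine ⟨(Matrix.posSemidef_vecMulVec_self_star _).smul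
    (Complex.nonneg_iff.mpr (by norm_num)), ?_⟩
  simp [Matrix.trace, bellState_apply, Fintype.sum_prod_type]

/-- The isometry with the columns `|b̄⟩ ⊗ t |b̄⟩`, where `t` is extended linearly. They
span the states of `Q S` with perfectly correlated outcomes in the
diagonal bases. -/
noncomputable def corrMatrix (t : Fin 2 → S) : Matrix (Fin 2 × S) (Fin 2) ℂ :=
  Matrix.of fun x b => diagKet b x.1 * ∑ p, if x.2 = t p then diagKet b p else 0

lemma corrMatrix_isometry {t : Fin 2 → S} (ht : Function.Injective t) :
    (corrMatrix t)ᴴ * corrMatrix t = 1 := by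
  have h1 : ∀ b b', ∑ s, (∑ p, if s = t p then diagKet b p else 0) *
      (∑ p, if s = t p then diagKet b' p else 0) = if b = b' then (1 : ℂ) else 0 := by
    intro b b'
    rw [← sum_diagKet_mul]
    simp only [Finset.sum_mul, Finset.mul_sum]
    rw [Finset.sum_comm]
    refine Finset.sum_congr rfl fun p _ => ?_
    rw [Finset.sum_comm]
    simp [ht.eq_iff]
  ext b b'
  have h2 : ((corrMatrix t)ᴴ * corrMatrix t) b b' = (∑ q, diagKet b q * diagKet b' q) *
      ∑ s, (∑ p, if s = t p then diagKet b p else 0) *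
        (∑ p, if s = t p then diagKet b' p else 0) := by
    rw [Matrix.mul_apply, Fintype.sum_prod_type, Finset.sum_mul_sum]
    refine Finset.sum_congr rfl fun q _ => Finset.sum_congr rfl fun s _ => ?_
    rw [Matrix.conjTranspose_apply, corrMatrix, Matrix.of_apply, Matrix.of_apply, star_mul',
      star_diagKet, star_sum]
    simp only [apply_ite star, star_diagKet, star_zero]
    ring
  rw [h2, h1, sum_diagKet_mul, Matrix.one_apply]
  split_ifs <;> simp

lemma posSemidef_one_sub_corrMatrix {t : Fin 2 → S} (ht : Function.Injective t) :
    (1 - corrMatrix t * (corrMatrix t)ᴴ).PosSemidef := by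
  have h : (1 - corrMatrix t * (corrMatrix t)ᴴ) =
      (1 - corrMatrix t * (corrMatrix t)ᴴ)ᴴ * (1 - corrMatrix t * (corrMatrix t)ᴴ) := by
    have h1 : corrMatrix t * (corrMatrix t)ᴴ * (corrMatrix t * (corrMatrix t)ᴴ) =
        corrMatrix t * (corrMatrix t)ᴴ := by
      rw [Matrix.mul_assoc, ← Matrix.mul_assoc _ᴴ, corrMatrix_isometry ht, Matrix.one_mul]
    rw [Matrix.conjTranspose_sub, Matrix.conjTranspose_mul, Matrix.conjTranspose_conjTranspose,
      Matrix.conjTranspose_one, sub_mul, one_mul, mul_sub, mul_one, h1, sub_self, sub_zero]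
  rw [h]
  exact Matrix.posSemidef_conjTranspose_mul_self _

lemma trace_corrMatrix_mul_eq_sum (t : Fin 2 → S) (ρ : Matrix (Fin 2 × S) (Fin 2 × S) ℂ) :
    (corrMatrix t * (corrMatrix t)ᴴ * ρ).trace =
      ∑ b, ∑ q, ∑ p, diagKet b q * diagKet b p *
        ∑ i, ∑ p', diagKet b i * diagKet b p' * ρ (q, t p) (i, t p') := by
  have h : ∀ (f : Fin 2 × S → ℂ) b, ∑ x, corrMatrix t x b * f x =
      ∑ q, ∑ p, diagKet b q * diagKet b p * f (q, t p) := by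
    intro f b
    rw [Fintype.sum_prod_type]
    refine Finset.sum_congr rfl fun q _ => ?_
    simp only [corrMatrix, Matrix.of_apply, Finset.mul_sum, Finset.sum_mul]
    rw [Finset.sum_comm]
    refine Finset.sum_congr rfl fun p _ => ?_
    simp
  have hs : ∀ x b, star (corrMatrix t x b) = corrMatrix t x b := by
    intro x b
    simp only [corrMatrix, Matrix.of_apply, star_mul', star_sum, apply_ite star, star_diagKet,
      star_zero]
  rw [Matrix.mul_assoc, Matrix.trace_mul_comm, Matrix.trace]
  refine Finset.sum_congr rfl fun b _ => ?_
  have h2 : ∀ x, ∑ i, ∑ p, diagKet b i * diagKet b p * ρ x (i, t p) =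
      ∑ y, corrMatrix t y b * ρ x y := fun x => (h (fun y => ρ x y) b).symm
  simp only [h2]
  rw [← h (fun x => ∑ y, corrMatrix t y b * ρ x y) b, Matrix.diag_apply,
    Matrix.mul_assoc, Matrix.mul_apply]
  refine Finset.sum_congr rfl fun x _ => ?_
  rw [Matrix.conjTranspose_apply, hs, Matrix.mul_apply]
  simp only [mul_comm]

/-- The probability that the outcomes in the diagonal bases agree, in terms of the states of `S`
conditioned on the outcomes of `Q`. -/
lemma trace_corrMatrix_mul (t : Fin 2 → S) (ρ : Matrix (Fin 2 × S) (Fin 2 × S) ℂ) :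
    (corrMatrix t * (corrMatrix t)ᴴ * ρ).trace =
      ∑ b, ∑ p, ∑ p', diagKet b p * diagKet b p' * measuredState (diagKet b) ρ (t p) (t p') := by
  rw [trace_corrMatrix_mul_eq_sum]
  refine Finset.sum_congr rfl fun b _ => ?_
  simp only [measuredState_apply, star_diagKet, Fin.sum_univ_two]
  ring

lemma measuredState_compKet_bellState (t : Fin 2 → S) (a : Fin 2) (s s' : S) :
    measuredState (compKet a) (bellState t) s s' =
      1 / 2 * ((if s = t a then 1 else 0) * if s' = t a then 1 else 0) := by
  rw [measuredState_apply, Finset.sum_eq_single a, Finset.sum_eq_single a]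
  · simp [compKet, bellState_apply]
  · intro q _ hq; simp [compKet, hq]
  · simp
  · intro i _ hi; simp [compKet, hi]
  · simp

lemma trace_corrMatrix_mul_bellState {t : Fin 2 → S} (ht : Function.Injective t) :
    (corrMatrix t * (corrMatrix t)ᴴ * bellState t).trace = 1 := by
  rw [trace_corrMatrix_mul_eq_sum]
  have h : ∀ b q : Fin 2, ∑ p, diagKet b q * diagKet b p *
      ∑ i, ∑ p', diagKet b i * diagKet b p' * bellState t (q, t p) (i, t p') = 1 / 4 := by
    intro b q
    rw [Finset.sum_eq_single q]
    · have h1 : ∀ i : Fin 2, ∑ p', diagKet b i * diagKet b p' * bellState t (q, t q) (i, t p') =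
          1 / 4 := by
        intro i
        rw [Finset.sum_eq_single i]
        · rw [diagKet_mul_self]
          norm_num [bellState_apply]
        · intro p' _ hp'
          simp [bellState_apply, ht.eq_iff, hp']
        · simp
      simp only [h1, diagKet_mul_self, Fin.sum_univ_two]
      norm_num
    · intro p _ hp
      simp [bellState_apply, ht.eq_iff, hp]
    · simp
  simp only [h]
  norm_num

/-- Compatibility with Alice's description forces the states conditioned on both outcomes to be
basis states, so that Bob's description has no coherence. -/
lemma trace_corrMatrix_mul_of_objective {t : Fin 2 → S} (ht : Function.Injective t)
    {ρ' : Matrix (Fin 2 × S) (Fin 2 × S) ℂ} (τ : Fin 2 → Fin 2 → Matrix S S ℂ)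
    (hτ : ∀ a b, (τ a b).PosSemidef)
    (hA : ∀ a, ∑ b, τ a b = measuredState (compKet a) (bellState t))
    (hB : ∀ b, ∑ a, τ a b = measuredState (diagKet b) ρ') :
    (corrMatrix t * (corrMatrix t)ᴴ * ρ').trace = 1 / 2 := by
  have hzero : ∀ a b p, a ≠ p → ∀ s, τ a b (t p) s = 0 ∧ τ a b s (t p) = 0 := by
    intro a b p hap s
    refine apply_eq_zero_of_diag_eq_zero (hτ a b) ?_ s
    have h1 : ∑ b, τ a b (t p) (t p) = 0 := by
      rw [← Matrix.sum_apply, hA, measuredState_compKet_bellState]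
      simp [ht.eq_iff, hap.symm]
    exact (Finset.sum_eq_zero_iff_of_nonneg fun b _ => (hτ a b).diag_nonneg).mp h1 b
      (Finset.mem_univ b)
  have hoff : ∀ b p p', p ≠ p' → ∑ a, τ a b (t p) (t p') = 0 := by
    intro b p p' hp
    refine Finset.sum_eq_zero fun a _ => ?_
    by_cases ha : a = p
    · exact (hzero a b p' (ha ▸ hp) _).2
    · exact (hzero a b p ha _).1
  rw [trace_corrMatrix_mul]
  have h1 : ∀ b p, ∑ p', diagKet b p * diagKet b p' * measuredState (diagKet b) ρ' (t p) (t p') =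
      1 / 2 * ∑ a, τ a b (t p) (t p) := by
    intro b p
    rw [Finset.sum_eq_single p]
    · rw [diagKet_mul_self, ← hB, Matrix.sum_apply]
    · intro p' _ hp
      rw [← hB, Matrix.sum_apply, hoff b p p' hp.symm, mul_zero]
    · simp
  simp only [h1, ← Finset.mul_sum]
  have h2 : ∑ b, ∑ p, ∑ a, τ a b (t p) (t p) = ∑ p, ∑ a, ∑ b, τ a b (t p) (t p) := by
    rw [Finset.sum_comm]
    exact Finset.sum_congr rfl fun p _ => Finset.sum_comm
  rw [h2]
  simp only [← Matrix.sum_apply, hA, measuredState_compKet_bellState, ht.eq_iff]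
  simp

end Paradox

/-- On a maximally entangled state of `Q S`, a decoder with error `ε` makes the outcomes in the
diagonal bases of `Q_R` and `S` agree with probability at least `1 - ε`, whereas objective outcomes
allow only `1 / 2`. -/
theorem not_executable_universal_objective {L B R B' R' : Type} [Fintype L] [DecidableEq L]
    [Fintype B] [DecidableEq B] [Fintype R] [DecidableEq R] [Fintype B'] [Fintype R']
    [DecidableEq R'] (X : Experiment L B R B' R') {ε : ℝ} (hε : ε < 1 / 2)
    (U : Matrix.unitaryGroup ((Fin 2 × L) × B) ℂ)
    (D : Matrix (R' × R) (R' × R) ℂ →ₗ[ℂ] Matrix (Fin 2) (Fin 2) ℂ)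
    {S : Type} [Fintype S] [DecidableEq S] [Nontrivial S] (d : Descriptions S) :
    ¬ (X.Executable U D ε ∧ UniversalQuantumTheory X U D d ∧ ObjectiveOutcomes d) := by
  rintro ⟨hD, hQ, F, hF⟩
  obtain ⟨s₀, s₁, hs⟩ := exists_pair_ne S
  let t : Fin 2 → S := ![s₀, s₁]
  have ht : Function.Injective t := by
    intro i j h
    fin_cases i <;> fin_cases j <;> simp_all [t]
  have hρ := isDensity_bellState t
  have h1 := hD.2 S (bellState t) hρ _ (Matrix.posSemidef_self_mul_conjTranspose (corrMatrix t))
    (posSemidef_one_sub_corrMatrix ht)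
  have h2 := trace_corrMatrix_mul_of_objective ht (ρ' := X.bobState U D S (bellState t))
    (fun a b => (F.prob (bellState t) a b : ℂ) • F.post (bellState t) a b)
    (fun a b => (F.post_density _ hρ a b).1.smul
      (Complex.zero_le_real.mpr (F.prob_nonneg _ hρ a b)))
    (fun a => ((hF _ hρ).1 a).trans ((hQ _ hρ).1 a))
    (fun b => ((hF _ hρ).2 b).trans ((hQ _ hρ).2 b))
  rw [h2, trace_corrMatrix_mul_bellState ht] at h1
  norm_num [abs_le] at h1
  linarith

end HaydenPreskill

theorem theorem4 (ε δ : ℝ) (hε : 0 < ε) (hε' : ε < 1 / 2) (hδ : 0 < δ) :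
    ∃ K : ℝ, 0 < K ∧
      ∀ (L B R B' R' : Type) [Fintype L] [DecidableEq L] [Fintype B] [DecidableEq B] [Nonempty B]
        [Fintype R] [DecidableEq R] [Fintype B'] [Fintype R'] [DecidableEq R']
        (X : Experiment L B R B' R'),
        K * (Fintype.card L : ℝ) ≤ (Fintype.card R' : ℝ) ^ 2 →
        haarUnitary ((Fin 2 × L) × B) {U | ¬ ∃ D, X.Executable U D ε} ≤ ENNReal.ofReal δ ∧
        ∀ (U : Matrix.unitaryGroup ((Fin 2 × L) × B) ℂ)
          (D : Matrix (R' × R) (R' × R) ℂ →ₗ[ℂ] Matrix (Fin 2) (Fin 2) ℂ)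
          (S : Type) [Fintype S] [DecidableEq S] [Nontrivial S] (d : Descriptions S),
          ¬ (X.Executable U D ε ∧ UniversalQuantumTheory X U D d ∧ ObjectiveOutcomes d) := by
  refine ⟨32 / (ε ^ 2 * δ), by positivity, ?_⟩
  intro L B R B' R' _ _ _ _ _ _ _ _ _ _ X h
  exact ⟨X.haarUnitary_not_executable_le hε hδ h,
    fun U D S _ _ _ d => not_executable_universal_objective X hε' U D d⟩
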